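/- For $\vec w=(w_1,\dots,w_d)$ with positive integer entries put $R_{\vec w}=\prod_{i=1}^d\{0,1,\dots,w_i-1\}\subset\mathbb Z^d$. Given an action $T$ of $\mathbb Z^d$ on a probability space $(X,\mathcal M,\mu)$, a Rohlin tower of shape $R_{\vec w}$ is a set of the form $\tau=\bigcup_{\vec v\in R_{\vec w}}T^{\vec v}F$, where $F\in\mathcal M$ and the sets $T^{\vec v}F$, $\vec v\in R_{\vec w}$, are pairwise disjoint. Theorem (Alpern multi-tower theorem for $\mathbb Z^d$, finitely many rectangles). Let $d,k\ge 1$, let $\vec w^1,\dots,\vec w^k\in\mathbb Z_{>0}^d$ satisfy $\gcd(w^1_i,\dots,w^k_i)=1$ for every $i=1,\dots,d$, and let $p_1,\dots,p_k>0$ satisfy $\sum_{j=1}^k p_j=1$. Let $T$ be a measure-preserving action of $\mathbb Z^d$ on a Lebesgue probability space $(X,\mathcal M,\mu)$ (a complete probability space isomorphic modulo null sets to $\mathbb R$ with the completion of a Borel probability measure), and suppose $T$ is free, in the sense that for $\mu$-almost every $x\in X$ one has $T^{\vec v}x\ne x$ for all $\vec v\neq \vec 0$. Then there are Rohlin towers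 $\tau^1,\dots,\tau^k$, with $\tau^j$ of shape $R_{\vec w^j}$, such that $\mu(\tau^j)=p_j$ for every $j$, $\tau^j\cap\tau^{j'}=\emptyset$ whenever $j\ne j'$, and $\bigcup_{j=1}^k\tau^j=X$ up to a $\mu$-null set. If moreover $T^{\vec v}x\neq x$ for every $x\in X$ and every $\vec v\ne\vec 0$, then the towers can be chosen so that in addition $\bigcup_{j=1}^k\tau^j=X$ exactly. -/

import Mathlib

open MeasureTheory

/-- A (Rokhlin) Lebesgue probability space: a complete probability space which is isomorphic
modulo null sets to the real line with the completion of a Borel probability measure `ν`.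
The isomorphism is a map `f` that is injective on a conull set `S`, has conull image, and
on subsets of `S` matches the measurable sets with the `ν`-completion-measurable sets and
the two measures with each other. -/
structure IsLebesgueProbabilitySpace {X : Type*} [MeasurableSpace X] (μ : Measure X) :
    Prop where
  isProbabilityMeasure : IsProbabilityMeasure μ
  isComplete : μ.IsComplete
  exists_iso : ∃ (ν : Measure ℝ) (f : X → ℝ) (S : Set X),
    IsProbabilityMeasure ν ∧ μ Sᶜ = 0 ∧ ν (f '' S)ᶜ = 0 ∧ Set.InjOn f S ∧
      (∀ A ⊆ S, MeasurableSet A ↔ NullMeasurableSet (f '' A) ν) ∧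
      (∀ A ⊆ S, MeasurableSet A → μ A = ν (f '' A))

/-- The rectangle `R_w = ∏ i, [0, w i - 1] ∩ ℤ` in `ℤ^d`. -/
def latticeRectangle {d : ℕ} (w : Fin d → ℕ) : Set (Fin d → ℤ) :=
  {v | ∀ i, 0 ≤ v i ∧ v i ≤ (w i : ℤ) - 1}

/-- `τ` is a Rohlin tower of shape `R_w` for the `ℤ^d` action on `X`: it is the union of the
translates `T^v F`, `v ∈ R_w`, of a measurable base `F`, and these translates are pairwise
disjoint. -/
def IsRohlinTower {d : ℕ} {X : Type*} [MeasurableSpace X] [AddAction (Fin d → ℤ) X]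
    (w : Fin d → ℕ) (τ : Set X) : Prop :=
  ∃ F : Set X, MeasurableSet F ∧
    (latticeRectangle w).PairwiseDisjoint (fun v => (fun x : X => v +ᵥ x) '' F) ∧
    τ = ⋃ v ∈ latticeRectangle w, (fun x : X => v +ᵥ x) '' F

/-! Call a finite `D ⊂ ℤ^d` balanced if `p * |D|` is a convex combination of the volume vectors of
tilings of `D` by the given rectangles. If almost every orbit is cut measurably into translates of
countably many balanced patches, the theorem follows: the measure is nonatomic, so the base of each
patch splits into pieces whose relative measures are the convex weights, one tiling being used over
each piece. The corners of the tiles of type `j` form the base of the `j`-th tower, and the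
proportions come out exactly (`HasDecomposition.exists_isMultiTower`).

Balanced sets come from slabs. If all sides of a box but one are multiples of a suitable `M` and the
last is at least `L`, the gcd condition lets a layer of bounded thickness correct the last side
modulo every rectangle. The rest can be tiled by any single type, and since `p j > 0` its mixtures
compensate for the layer (`balanced_slab`). Cutting into slabs shows that a cube minus cubes that
are nested or well separated is balanced (`balanced_sdiff_cubes`).

To produce such patches, markers are chosen at rapidly growing scales `s n`, each carrying a cube of
side `s n`. A cube meeting the boundary zone of a larger cube is discarded; this costs at most half
of each level (`measure_unclashed_ge`). A point belongs to the patch of the lowest-level surviving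
cube containing it. The orbits that are entirely covered fill a set of positive measure inside any
invariant set of positive measure, and exhaustion makes the covered set conull. When the action is
free everywhere, the remaining null set is tiled by choice with a single rectangle. -/

/-! ### Tilings, balanced sets and Bézout combinations -/

namespace LatticeTiling

/-- The finite box `∏ i, [a i, b i)` in `ℤ^d`. -/
noncomputable def box {d : ℕ} (a b : Fin d → ℤ) : Finset (Fin d → ℤ) :=
  Fintype.piFinset fun i => Finset.Ico (a i) (b i)

@[simp]
theorem mem_box {d : ℕ} {a b x : Fin d → ℤ} : x ∈ box a b ↔ ∀ i, a i ≤ x i ∧ x i < b i := by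
  simp [box]

theorem card_box {d : ℕ} (a b : Fin d → ℤ) : (box a b).card = ∏ i, (b i - a i).toNat := by
  simp [box]

/-- The translate by `q.2` of the rectangle with side lengths `w q.1`. -/
noncomputable def tile {d k : ℕ} (w : Fin k → Fin d → ℕ) (q : Fin k × (Fin d → ℤ)) :
    Finset (Fin d → ℤ) :=
  box q.2 (fun i => q.2 i + w q.1 i)

/-- `t` is a tiling of `D` by translates of the rectangles `w`. -/
structure IsTiling {d k : ℕ} (w : Fin k → Fin d → ℕ) (t : Finset (Fin k × (Fin d → ℤ)))
    (D : Finset (Fin d → ℤ)) : Prop where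
  disj : (t : Set (Fin k × (Fin d → ℤ))).PairwiseDisjoint (tile w)
  cover : t.biUnion (tile w) = D

/-- The number of lattice points covered by the tiles of each kind. -/
noncomputable def tileVolume {d k : ℕ} (w : Fin k → Fin d → ℕ)
    (t : Finset (Fin k × (Fin d → ℤ))) : Fin k → ℝ :=
  ∑ q ∈ t, Pi.single q.1 ((tile w q).card : ℝ)

/-- `D` admits tilings whose volume vectors average to `p` times the cardinality of `D`. -/
def Balanced {d k : ℕ} (w : Fin k → Fin d → ℕ) (p : Fin k → ℝ) (D : Finset (Fin d → ℤ)) : Prop :=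
  (fun j => p j * D.card) ∈ convexHull ℝ {φ | ∃ t, IsTiling w t D ∧ tileVolume w t = φ}

variable {d k : ℕ} {w : Fin k → Fin d → ℕ} {p : Fin k → ℝ}

theorem tile_nonempty (hw : ∀ j i, 0 < w j i) (q : Fin k × (Fin d → ℤ)) : (tile w q).Nonempty :=
  ⟨q.2, by simpa [tile] using fun i => hw q.1 i⟩

theorem isTiling_empty : IsTiling w ∅ ∅ := ⟨by simp, by simp⟩

theorem IsTiling.union {t₁ t₂ : Finset (Fin k × (Fin d → ℤ))} {D₁ D₂ : Finset (Fin d → ℤ)}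
    (h₁ : IsTiling w t₁ D₁) (h₂ : IsTiling w t₂ D₂) (hD : Disjoint D₁ D₂) :
    IsTiling w (t₁ ∪ t₂) (D₁ ∪ D₂) := by
  refine ⟨?_, by rw [Finset.union_biUnion, h₁.cover, h₂.cover]⟩
  rw [Finset.coe_union, Set.pairwiseDisjoint_union]
  refine ⟨h₁.disj, h₂.disj, fun q hq r hr _ => ?_⟩
  refine Finset.disjoint_of_subset_left ?_ (Finset.disjoint_of_subset_right ?_ hD)
  · rw [← h₁.cover]; exact Finset.subset_biUnion_of_mem (tile w) hq
  · rw [← h₂.cover]; exact Finset.subset_biUnion_of_mem (tile w) hr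

theorem IsTiling.disjoint (hw : ∀ j i, 0 < w j i) {t₁ t₂ : Finset (Fin k × (Fin d → ℤ))}
    {D₁ D₂ : Finset (Fin d → ℤ)} (h₁ : IsTiling w t₁ D₁) (h₂ : IsTiling w t₂ D₂)
    (hD : Disjoint D₁ D₂) : Disjoint t₁ t₂ := by
  rw [Finset.disjoint_left]
  intro q hq hq'
  obtain ⟨x, hx⟩ := tile_nonempty hw q
  rw [← h₁.cover, ← h₂.cover] at hD
  exact Finset.disjoint_left.1 hD (Finset.mem_biUnion.2 ⟨q, hq, hx⟩)
    (Finset.mem_biUnion.2 ⟨q, hq', hx⟩)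

theorem IsTiling.tileVolume_union (hw : ∀ j i, 0 < w j i) {t₁ t₂ : Finset (Fin k × (Fin d → ℤ))}
    {D₁ D₂ : Finset (Fin d → ℤ)} (h₁ : IsTiling w t₁ D₁) (h₂ : IsTiling w t₂ D₂)
    (hD : Disjoint D₁ D₂) : tileVolume w (t₁ ∪ t₂) = tileVolume w t₁ + tileVolume w t₂ :=
  Finset.sum_union (h₁.disjoint hw h₂ hD)

theorem IsTiling.sum_card {t : Finset (Fin k × (Fin d → ℤ))} {D : Finset (Fin d → ℤ)}
    (h : IsTiling w t D) : ∑ q ∈ t, (tile w q).card = D.card := by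
  rw [← h.cover, Finset.card_biUnion]
  exact fun q hq r hr => h.disj hq hr

theorem IsTiling.sum_tileVolume {t : Finset (Fin k × (Fin d → ℤ))} {D : Finset (Fin d → ℤ)}
    (h : IsTiling w t D) : ∑ j, tileVolume w t j = D.card := by
  rw [← h.sum_card]
  simp only [tileVolume, Finset.sum_apply]
  rw [Finset.sum_comm]
  simp

theorem tileVolume_nonneg (t : Finset (Fin k × (Fin d → ℤ))) (j : Fin k) :
    0 ≤ tileVolume w t j := by
  simp only [tileVolume, Finset.sum_apply]
  refine Finset.sum_nonneg fun q _ => ?_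
  by_cases h : j = q.1
  · subst h; simp
  · simp [h]

theorem IsTiling.tileVolume_le {t : Finset (Fin k × (Fin d → ℤ))} {D : Finset (Fin d → ℤ)}
    (h : IsTiling w t D) (j : Fin k) : tileVolume w t j ≤ D.card := by
  rw [← h.sum_tileVolume]
  exact Finset.single_le_sum (fun j _ => tileVolume_nonneg t j) (Finset.mem_univ j)

theorem balanced_empty : Balanced w p ∅ := by
  refine subset_convexHull ℝ _ ⟨∅, isTiling_empty, ?_⟩
  ext j
  simp [tileVolume]

/-- Volume vectors of tilings of disjoint sets add, and the convex hull of a Minkowski sum is the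
sum of the convex hulls. -/
theorem Balanced.union (hw : ∀ j i, 0 < w j i) {D₁ D₂ : Finset (Fin d → ℤ)}
    (h₁ : Balanced w p D₁) (h₂ : Balanced w p D₂) (hD : Disjoint D₁ D₂) :
    Balanced w p (D₁ ∪ D₂) := by
  have h := Set.add_mem_add h₁ h₂
  rw [← convexHull_add] at h
  have e : (fun j => p j * ((D₁ ∪ D₂).card : ℝ)) =
      (fun j => p j * (D₁.card : ℝ)) + fun j => p j * (D₂.card : ℝ) := by
    ext j
    simp [Finset.card_union_of_disjoint hD, mul_add]
  unfold Balanced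
  rw [e]
  refine convexHull_mono ?_ h
  rintro _ ⟨_, ⟨t₁, ht₁, rfl⟩, _, ⟨t₂, ht₂, rfl⟩, rfl⟩
  exact ⟨t₁ ∪ t₂, ht₁.union ht₂ hD, ht₁.tileVolume_union hw ht₂ hD⟩

theorem balanced_biUnion (hw : ∀ j i, 0 < w j i) {ι : Type*} (s : Finset ι)
    (D : ι → Finset (Fin d → ℤ)) (hD : (s : Set ι).PairwiseDisjoint D)
    (h : ∀ i ∈ s, Balanced w p (D i)) : Balanced w p (s.biUnion D) := by
  classical
  induction s using Finset.induction_on with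
  | empty => simpa using balanced_empty
  | insert i s hi ih =>
    rw [Finset.biUnion_insert]
    refine (h i (by simp)).union hw (ih (hD.subset (by simp)) fun j hj => h j (by simp [hj])) ?_
    rw [Finset.disjoint_biUnion_right]
    intro j hj
    refine hD (by simp) (by simp [hj]) ?_
    rintro rfl
    exact hi hj

/-- A box whose sides are multiples of those of the rectangle `w j` is tiled by it. -/
theorem exists_tiling_of_dvd (hw : ∀ j i, 0 < w j i) (j : Fin k) (a b : Fin d → ℤ)
    (h : ∀ i, (w j i : ℤ) ∣ b i - a i) :
    ∃ t, IsTiling w t (box a b) ∧ tileVolume w t = Pi.single j ((box a b).card : ℝ) := by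
  classical
  have hw' : ∀ i, (0 : ℤ) < w j i := fun i => by exact_mod_cast hw j i
  let t : Finset (Fin k × (Fin d → ℤ)) := (box 0 fun i => (b i - a i) / w j i).image
    fun u => (j, fun i => a i + w j i * u i)
  have key : ∀ (y u : ℤ) (m : ℕ), 0 < m → (m * u ≤ y ∧ y < m * u + m ↔ u = y / m) := by
    intro y u m hm
    have hm' : (0 : ℤ) < m := by exact_mod_cast hm
    have h1 := Int.ediv_mul_le y hm'.ne'
    have h2 := Int.lt_ediv_add_one_mul_self y hm'
    constructor
    · rintro ⟨h3, h4⟩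
      have h5 : u < y / m + 1 := by
        by_contra! hc
        nlinarith
      have h6 : y / m < u + 1 := by
        by_contra! hc
        nlinarith
      omega
    · rintro rfl
      constructor <;> nlinarith
  have mem_tile : ∀ (u x : Fin d → ℤ), x ∈ tile w (j, fun i => a i + w j i * u i) ↔
      u = fun i => (x i - a i) / w j i := by
    intro u x
    simp only [tile, mem_box, funext_iff]
    refine forall_congr' fun i => ?_
    rw [← key _ _ _ (hw j i)]
    constructor <;> rintro ⟨h1, h2⟩ <;> constructor <;> linarith
  have ht : IsTiling w t (box a b) := by
    constructor
    · intro q hq r hr hqr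
      simp only [t, Finset.coe_image, Set.mem_image] at hq hr
      obtain ⟨u, -, rfl⟩ := hq
      obtain ⟨u', -, rfl⟩ := hr
      refine Finset.disjoint_left.2 fun x hx hx' => hqr ?_
      rw [mem_tile] at hx hx'
      rw [hx, hx']
    · ext x
      simp only [t, Finset.mem_biUnion, Finset.mem_image]
      constructor
      · rintro ⟨_, ⟨u, hu, rfl⟩, hx⟩
        rw [mem_tile] at hx
        rw [mem_box] at hu ⊢
        intro i
        obtain ⟨c, hc⟩ := h i
        obtain ⟨h1, h2⟩ := hu i
        rw [hx] at h1 h2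
        simp only [Pi.zero_apply] at h1
        rw [hc, Int.mul_ediv_cancel_left _ (hw' i).ne'] at h2
        have h3 := Int.ediv_mul_le (x i - a i) (hw' i).ne'
        have h4 := Int.lt_ediv_add_one_mul_self (x i - a i) (hw' i)
        constructor
        · nlinarith [hw' i]
        · nlinarith [hw' i]
      · intro hx
        rw [mem_box] at hx
        refine ⟨_, ⟨fun i => (x i - a i) / w j i, ?_, rfl⟩, (mem_tile _ _).2 rfl⟩
        rw [mem_box]
        intro i
        obtain ⟨h1, h2⟩ := hx i
        refine ⟨Int.ediv_nonneg (by linarith) (hw' i).le, ?_⟩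
        obtain ⟨c, hc⟩ := h i
        rw [hc, Int.mul_ediv_cancel_left _ (hw' i).ne']
        apply Int.ediv_lt_of_lt_mul (hw' i)
        linarith
  refine ⟨t, ht, ?_⟩
  rw [← ht.sum_card, Nat.cast_sum, tileVolume]
  have : ∀ q ∈ t, q.1 = j := by
    intro q hq
    obtain ⟨u, -, rfl⟩ := Finset.mem_image.1 hq
    rfl
  rw [Finset.sum_congr rfl fun q hq => by rw [this q hq]]
  ext l
  simp only [Finset.sum_apply]
  by_cases hl : l = j
  · subst hl; simp
  · simp [hl]

/-- Bézout coefficients scaled by `h` and reduced modulo `W`: they become natural numbers, the sum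
changes only by a multiple of `W`, and the bound `c l < W` keeps it bounded independently of `h`. -/
theorem exists_nat_combination {v : Fin k → ℕ} (hv : Finset.univ.gcd v = 1) {W : ℕ} (hW : 0 < W)
    (h : ℤ) : ∃ c : Fin k → ℕ, (∀ l, c l < W) ∧ (W : ℤ) ∣ h - ∑ l, (c l * v l : ℤ) := by
  obtain ⟨f, hf⟩ := Finset.gcd_eq_sum_mul Finset.univ fun l => (v l : ℤ)
  have hg : Finset.univ.gcd (fun l => (v l : ℤ)) ∣ 1 := by
    rw [← Int.natAbs_dvd_natAbs, Int.natAbs_one, ← hv]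
    refine Finset.dvd_gcd fun l _ => ?_
    rw [← Int.natAbs_natCast (v l)]
    exact Int.natAbs_dvd_natAbs.2 (Finset.gcd_dvd (Finset.mem_univ l))
  obtain ⟨u, hu⟩ := hg
  have hW' : (0 : ℤ) < W := by exact_mod_cast hW
  refine ⟨fun l => ((h * u * f l) % W).toNat, fun l => ?_, ?_⟩
  · have := Int.emod_lt_of_pos (h * u * f l) hW'
    have := Int.emod_nonneg (h * u * f l) hW'.ne'
    dsimp only
    omega
  · have e : h = ∑ l, h * u * f l * v l := by
      calc h = h * (Finset.univ.gcd (fun l => (v l : ℤ)) * u) := by rw [← hu, mul_one]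
        _ = _ := by
          rw [hf, Finset.sum_mul, Finset.mul_sum]
          exact Finset.sum_congr rfl fun l _ => by ring
    nth_rewrite 1 [e]
    rw [← Finset.sum_sub_distrib]
    refine Finset.dvd_sum fun l _ => ?_
    rw [← sub_mul]
    refine Dvd.dvd.mul_right ?_ _
    rw [Int.toNat_of_nonneg (Int.emod_nonneg _ hW'.ne')]
    exact Int.dvd_self_sub_emod

end LatticeTiling

/-! ### Slabs are balanced -/

namespace LatticeTiling

variable {d k : ℕ} {w : Fin k → Fin d → ℕ} {p : Fin k → ℝ}

theorem mem_box_update {c e x : Fin d → ℤ} {i : Fin d} {m n : ℤ} :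
    x ∈ box (Function.update c i m) (Function.update e i n) ↔
      (∀ i', i' ≠ i → c i' ≤ x i' ∧ x i' < e i') ∧ m ≤ x i ∧ x i < n := by
  rw [mem_box]
  constructor
  · intro h
    refine ⟨fun i' hi' => by simpa [hi'] using h i', by simpa using h i⟩
  · rintro ⟨h1, h2⟩ i'
    by_cases hi' : i' = i
    · subst hi'; simpa using h2
    · simpa [hi'] using h1 i' hi'

theorem mem_box_iff_of_ne {c e x : Fin d → ℤ} (i : Fin d) :
    x ∈ box c e ↔ (∀ i', i' ≠ i → c i' ≤ x i' ∧ x i' < e i') ∧ c i ≤ x i ∧ x i < e i := by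
  rw [← mem_box_update, Function.update_eq_self, Function.update_eq_self]

theorem box_update_union {c e : Fin d → ℤ} (i : Fin d) {m n q : ℤ} (hm : m ≤ n) (hn : n ≤ q) :
    box (Function.update c i m) (Function.update e i n) ∪
      box (Function.update c i n) (Function.update e i q) =
      box (Function.update c i m) (Function.update e i q) := by
  ext x
  rw [Finset.mem_union, mem_box_update, mem_box_update, mem_box_update, ← and_or_left]
  refine and_congr_right fun _ => ?_
  omega

theorem disjoint_box_update {c e : Fin d → ℤ} (i : Fin d) {m n q r : ℤ} (hn : n ≤ q) :
    Disjoint (box (Function.update c i m) (Function.update e i n))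
      (box (Function.update c i q) (Function.update e i r)) := by
  rw [Finset.disjoint_left]
  intro x hx hx'
  rw [mem_box_update] at hx hx'
  omega

theorem card_box_update (c e : Fin d → ℤ) (i : Fin d) (m n : ℤ) :
    (box (Function.update c i m) (Function.update e i n)).card =
      (∏ i' ∈ Finset.univ.erase i, (e i' - c i').toNat) * (n - m).toNat := by
  rw [card_box, ← Finset.prod_erase_mul _ _ (Finset.mem_univ i)]
  congr 1
  · refine Finset.prod_congr rfl fun i' hi' => ?_
    simp [Finset.ne_of_mem_erase hi']
  · simp

/-- Layers of height `c l * w l i` are piled up in direction `i`, the layer of index `l` being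
filled with rectangles of type `l` alone. -/
theorem exists_tiling_stack (hw : ∀ j i, 0 < w j i) (i : Fin d) (c : Fin k → ℕ)
    (a b : Fin d → ℤ) (hdvd : ∀ l, ∀ i', i' ≠ i → (w l i' : ℤ) ∣ b i' - a i')
    (s : Finset (Fin k)) :
    ∃ t, IsTiling w t (box (Function.update a i (a i))
      (Function.update b i (a i + ∑ l ∈ s, (c l * w l i : ℤ)))) := by
  classical
  induction s using Finset.induction_on with
  | empty =>
    refine ⟨∅, ?_⟩
    convert isTiling_empty
    ext x
    rw [mem_box_update]
    simp
  | insert l s hl ih =>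
    obtain ⟨t, ht⟩ := ih
    obtain ⟨t', ht', -⟩ := exists_tiling_of_dvd hw l
      (Function.update a i (a i + ∑ l ∈ s, (c l * w l i : ℤ)))
      (Function.update b i (a i + ∑ l ∈ insert l s, (c l * w l i : ℤ))) (by
        intro i'
        by_cases hi' : i' = i
        · subst hi'
          simp [Finset.sum_insert hl]
        · simpa [hi'] using hdvd l i' hi')
    refine ⟨t ∪ t', ?_⟩
    have h0 : (0 : ℤ) ≤ ∑ l ∈ s, (c l * w l i : ℤ) := Finset.sum_nonneg fun _ _ => by positivity
    have h1 : (0 : ℤ) ≤ c l * w l i := by positivity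
    rw [← box_update_union i (n := a i + ∑ l ∈ s, (c l * w l i : ℤ)) (by linarith)
      (by rw [Finset.sum_insert hl]; linarith)]
    exact ht.union ht' (disjoint_box_update i le_rfl)

/-- The vertices of this simplex are the volume vectors of tilings that use a single type. -/
theorem mem_convexHull_single {q : Fin k → ℝ} (hq : ∀ j, 0 ≤ q j) (h : 0 < ∑ j, q j) :
    q ∈ convexHull ℝ (Set.range fun j => Pi.single j (∑ j, q j) : Set (Fin k → ℝ)) := by
  have e : q = ∑ j, (q j / ∑ j, q j) • (Pi.single j (∑ j, q j) : Fin k → ℝ) := by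
    ext l
    simp only [Finset.sum_apply, Pi.smul_apply, smul_eq_mul, Pi.single_apply]
    simp [h.ne']
  rw [e]
  refine (convex_convexHull ℝ _).sum_mem (fun j _ => div_nonneg (hq j) h.le) ?_ fun j _ =>
    subset_convexHull ℝ _ ?_
  · rw [← Finset.sum_div, div_self h.ne']
  · exact ⟨j, by rw [← e]⟩

/-- A bottom layer of height `S ≤ B`, with `S` congruent to the side modulo `W`, is tiled somehow;
what remains has all sides divisible by `W` and is tiled by any one type. The layer uses at most the
proportion `B / L ≤ p j` of the box, so the volume still owed to each type is nonnegative and is a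
mixture of the tilings of the remainder. -/
theorem balanced_slab (hw : ∀ j i, 0 < w j i)
    (hgcd : ∀ i, Finset.univ.gcd (fun j => w j i) = 1) (hsum : ∑ j, p j = 1)
    {W B L : ℕ} (hW : 0 < W) (hwW : ∀ j i, w j i ∣ W) (hB : ∀ i, ∑ l, W * w l i ≤ B)
    (hL : B < L) (hpL : ∀ j, (B : ℝ) ≤ p j * L) (hp : ∀ j, 0 < p j)
    (a b : Fin d → ℤ) (i : Fin d) (hab : ∀ i', i' ≠ i → (W : ℤ) ∣ b i' - a i')
    (hi : (L : ℤ) ≤ b i - a i) : Balanced w p (box a b) := by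
  obtain ⟨c, hc, hcW⟩ := exists_nat_combination (hgcd i) hW (b i - a i)
  have hwW' : ∀ j i, (w j i : ℤ) ∣ W := fun j i => by exact_mod_cast hwW j i
  obtain ⟨t₀, ht₀⟩ := exists_tiling_stack hw i c a b
    (fun l i' hi' => (hwW' l i').trans (hab i' hi')) Finset.univ
  set S : ℤ := ∑ l, (c l * w l i : ℤ) with hS
  have hS0 : 0 ≤ S := Finset.sum_nonneg fun _ _ => by positivity
  have hSB : S ≤ B := by
    refine le_trans ?_ (show ((∑ l, W * w l i : ℕ) : ℤ) ≤ B by exact_mod_cast hB i)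
    push_cast
    refine Finset.sum_le_sum fun l _ => ?_
    have : (c l : ℤ) ≤ W := by exact_mod_cast (hc l).le
    gcongr
  have hSi : a i + S < b i := by
    have : (B : ℤ) < L := by exact_mod_cast hL
    linarith
  set D₁ := box (Function.update a i (a i)) (Function.update b i (a i + S)) with hD₁
  set D₂ := box (Function.update a i (a i + S)) (Function.update b i (b i)) with hD₂
  have hdisj : Disjoint D₁ D₂ := disjoint_box_update i le_rfl
  have hD : D₁ ∪ D₂ = box a b := by
    rw [hD₁, hD₂, box_update_union i (by linarith) hSi.le, Function.update_eq_self,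
      Function.update_eq_self]
  choose t ht hvol using fun j => exists_tiling_of_dvd hw j
    (Function.update a i (a i + S)) (Function.update b i (b i)) (by
      intro i'
      by_cases hi' : i' = i
      · subst hi'
        simp only [Function.update_self]
        refine (hwW' j i').trans ?_
        rwa [← sub_sub]
      · simpa [hi'] using (hwW' j i').trans (hab i' hi'))
  set A : ℕ := ∏ i' ∈ Finset.univ.erase i, (b i' - a i').toNat with hA
  have c₁ : (D₁.card : ℝ) = A * S := by
    rw [hD₁, card_box_update, ← hA]
    push_cast
    rw [add_sub_cancel_left]
    congr 1
    exact_mod_cast Int.toNat_of_nonneg hS0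
  have c₂ : (D₂.card : ℝ) = A * ((b i - a i : ℤ) - S) := by
    rw [hD₂, card_box_update, ← hA]
    push_cast
    congr 1
    have : ((b i - (a i + S)).toNat : ℤ) = b i - a i - S := by omega
    exact_mod_cast this
  have cD : ((box a b).card : ℝ) = D₁.card + D₂.card := by
    rw [← hD, Finset.card_union_of_disjoint hdisj, Nat.cast_add]
  -- With an empty cross-section the box is empty; otherwise the remainder has positive volume, as
  -- the simplex argument requires.
  rcases Nat.eq_zero_or_pos A with hA0 | hA0
  · have : (box a b).card = 0 := by
      have : ((box a b).card : ℝ) = 0 := by rw [cD, c₁, c₂, hA0]; simp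
      exact_mod_cast this
    rw [Finset.card_eq_zero.1 this]
    exact balanced_empty
  have hA0' : (0 : ℝ) < A := by exact_mod_cast hA0
  set q : Fin k → ℝ := fun j => p j * (box a b).card - tileVolume w t₀ j with hq
  have hqsum : ∑ j, q j = D₂.card := by
    rw [hq, Finset.sum_sub_distrib, ← Finset.sum_mul, hsum, ht₀.sum_tileVolume, cD]
    ring
  have hD₂pos : (0 : ℝ) < D₂.card := by
    rw [c₂]
    refine mul_pos hA0' ?_
    have : (0 : ℤ) < b i - a i - S := by linarith
    exact_mod_cast this
  have hq0 : ∀ j, 0 ≤ q j := by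
    intro j
    have h1 := ht₀.tileVolume_le j
    have h2 : (S : ℝ) ≤ B := by exact_mod_cast hSB
    have h3 : (L : ℝ) ≤ (b i - a i : ℤ) := by exact_mod_cast hi
    have h4 : p j * L ≤ p j * (b i - a i : ℤ) := mul_le_mul_of_nonneg_left h3 (hp j).le
    have h5 := hpL j
    have h6 : (A : ℝ) * S ≤ A * (p j * (b i - a i : ℤ)) :=
      mul_le_mul_of_nonneg_left (by linarith) hA0'.le
    simp only [hq]
    rw [cD]
    rw [c₁] at h1 ⊢
    rw [c₂]
    linarith
  have hmem := mem_convexHull_single hq0 (by rw [hqsum]; exact hD₂pos)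
  have hadd := Set.add_mem_add (Set.mem_singleton (tileVolume w t₀)) hmem
  rw [← convexHull_singleton (𝕜 := ℝ) (tileVolume w t₀), ← convexHull_add, hqsum] at hadd
  have e : (fun j => p j * ((box a b).card : ℝ)) = tileVolume w t₀ + q := by
    ext j; simp [hq]
  unfold Balanced
  rw [e]
  refine convexHull_mono ?_ hadd
  rintro _ ⟨_, rfl, _, ⟨j, rfl⟩, rfl⟩
  refine ⟨t₀ ∪ t j, ?_, ?_⟩
  · rw [← hD]; exact ht₀.union (ht j) hdisj
  · rw [ht₀.tileVolume_union hw (ht j) hdisj, hvol j]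

theorem exists_balanced_slab (hw : ∀ j i, 0 < w j i)
    (hgcd : ∀ i, Finset.univ.gcd (fun j => w j i) = 1) (hsum : ∑ j, p j = 1)
    (hp : ∀ j, 0 < p j) :
    ∃ M L : ℕ, 0 < L ∧ L ≤ M ∧ ∀ (a b : Fin d → ℤ) (i : Fin d),
      (∀ i', i' ≠ i → (M : ℤ) ∣ b i' - a i') → (L : ℤ) ≤ b i - a i → Balanced w p (box a b) := by
  set W : ℕ := ∏ j, ∏ i, w j i with hW
  have hW0 : 0 < W := Finset.prod_pos fun j _ => Finset.prod_pos fun i _ => hw j i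
  set B : ℕ := ∑ i, ∑ l, W * w l i with hB
  obtain ⟨N, hN⟩ : ∃ N : ℕ, ∀ j, (B : ℝ) / p j ≤ N := by
    obtain ⟨r, hr⟩ := (Set.finite_range fun j => (B : ℝ) / p j).bddAbove
    obtain ⟨N, hN⟩ := exists_nat_ge r
    exact ⟨N, fun j => (hr ⟨j, rfl⟩).trans hN⟩
  -- `L` exceeds both `B` and every `B / p j`. The modulus `W * L` is a multiple of `W` and at least
  -- `L`, so a cube with that side is itself a slab.
  set L := N + B + 1 with hL
  refine ⟨W * L, L, by omega, Nat.le_mul_of_pos_left _ hW0, fun a b i hab hi => ?_⟩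
  refine balanced_slab hw hgcd hsum hW0 (fun j i => ?_) (B := B) (L := L) (fun i => ?_) (by omega)
    (fun j => ?_) hp a b i (fun i' hi' => ?_) hi
  · exact (Finset.dvd_prod_of_mem (fun i => w j i) (Finset.mem_univ i)).trans
      (Finset.dvd_prod_of_mem (fun j => ∏ i, w j i) (Finset.mem_univ j))
  · exact Finset.single_le_sum (f := fun i => ∑ l, W * w l i) (fun _ _ => Nat.zero_le _)
      (Finset.mem_univ i)
  · have h1 := (div_le_iff₀ (hp j)).1 (hN j)
    have h2 : (N : ℝ) ≤ L := by exact_mod_cast (by omega : N ≤ L)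
    nlinarith [hp j]
  · refine Dvd.dvd.trans ?_ (hab i' hi')
    push_cast
    exact Dvd.intro _ rfl

/-! ### Cubes with holes are balanced -/

section Cubes

variable {M L : ℕ}

/-- The outer box is shrunk to the inner one a coordinate at a time. Each step removes two slabs of
thickness at least `L`, whose other sides are sides of the inner or outer box and hence multiples of
`M`. -/
theorem balanced_annulus (hw : ∀ j i, 0 < w j i)
    (hslab : ∀ (a b : Fin d → ℤ) (i : Fin d),
      (∀ i', i' ≠ i → (M : ℤ) ∣ b i' - a i') → (L : ℤ) ≤ b i - a i → Balanced w p (box a b))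
    {a b a' b' : Fin d → ℤ} (hM : ∀ i, (M : ℤ) ∣ b i - a i) (hM' : ∀ i, (M : ℤ) ∣ b' i - a' i)
    (hab : ∀ i, a i ≤ b i) (ha : ∀ i, a' i + L ≤ a i) (hb : ∀ i, b i + L ≤ b' i) :
    Balanced w p (box a' b' \ box a b) := by
  -- `T` is the set of coordinates that have already been shrunk.
  suffices h : ∀ T : Finset (Fin d),
      Balanced w p (box a' b' \ box (T.piecewise a a') (T.piecewise b b')) by
    simpa using h Finset.univ
  intro T
  induction T using Finset.induction_on with
  | empty => simpa using balanced_empty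
  | insert i T hi ih =>
    set c := T.piecewise a a' with hc
    set e := T.piecewise b b' with he
    have hci : c i = a' i := by simp [hc, hi]
    have hei : e i = b' i := by simp [he, hi]
    have hai := ha i
    have hbi := hb i
    have habi := hab i
    have hsub : box c e ⊆ box a' b' := by
      intro x hx
      rw [mem_box] at hx ⊢
      intro i'
      have h1 := hx i'
      have h2 := ha i'
      have h3 := hb i'
      by_cases hi' : i' ∈ T
      · simp only [hc, he, hi', Finset.piecewise_eq_of_mem] at h1
        omega
      · simpa [hc, he, hi'] using h1
    have hdvd : ∀ i', (M : ℤ) ∣ e i' - c i' := by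
      intro i'
      by_cases hi' : i' ∈ T
      · simpa [hc, he, hi'] using hM i'
      · simpa [hc, he, hi'] using hM' i'
    have s₁ : Balanced w p (box (Function.update c i (a' i)) (Function.update e i (a i))) := by
      refine hslab _ _ i (fun i' hi' => by simpa [hi'] using hdvd i') ?_
      simp only [Function.update_self]
      omega
    have s₂ : Balanced w p (box (Function.update c i (b i)) (Function.update e i (b' i))) := by
      refine hslab _ _ i (fun i' hi' => by simpa [hi'] using hdvd i') ?_
      simp only [Function.update_self]
      omega
    have heq : box a' b' \ box ((insert i T).piecewise a a') ((insert i T).piecewise b b') =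
        (box a' b' \ box c e) ∪
          (box (Function.update c i (a' i)) (Function.update e i (a i)) ∪
            box (Function.update c i (b i)) (Function.update e i (b' i))) := by
      rw [Finset.piecewise_insert, Finset.piecewise_insert, ← hc, ← he]
      ext x
      have hx := @hsub x
      rw [mem_box_iff_of_ne i, hci, hei] at hx
      simp only [Finset.mem_union, Finset.mem_sdiff, mem_box_update]
      rw [mem_box_iff_of_ne (c := c) i, hci, hei]
      generalize (∀ i', i' ≠ i → c i' ≤ x i' ∧ x i' < e i') = P at hx ⊢
      by_cases hP : P
      · by_cases hQ : x ∈ box a' b'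
        · simp only [hP, hQ, true_and]
          omega
        · simp only [hP, hQ, true_and, imp_false, false_and, false_or, false_iff] at hx ⊢
          omega
      · simp [hP]
    rw [heq]
    refine ih.union hw (s₁.union hw s₂ (disjoint_box_update i habi)) ?_
    rw [Finset.disjoint_left]
    intro x hx hx'
    rw [Finset.mem_sdiff, mem_box_iff_of_ne (c := c) i, hci, hei] at hx
    rw [Finset.mem_union, mem_box_update, mem_box_update] at hx'
    rcases hx' with ⟨h1, h2⟩ | ⟨h1, h2⟩
    · exact hx.2 ⟨h1, by omega⟩
    · exact hx.2 ⟨h1, by omega⟩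

/-- Such a set is a union of cells of the grid of mesh `M`, and each cell is a slab because `L ≤ M`.
-/
theorem balanced_of_saturated (hd : 0 < d) (hw : ∀ j i, 0 < w j i) (hL : 0 < L) (hLM : L ≤ M)
    (hslab : ∀ (a b : Fin d → ℤ) (i : Fin d),
      (∀ i', i' ≠ i → (M : ℤ) ∣ b i' - a i') → (L : ℤ) ≤ b i - a i → Balanced w p (box a b))
    (E : Finset (Fin d → ℤ))
    (hE : ∀ x ∈ E, ∀ y : Fin d → ℤ, (∀ i, y i / M = x i / M) → y ∈ E) : Balanced w p E := by
  classical
  have hM : (0 : ℤ) < M := by exact_mod_cast hL.trans_le hLM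
  have mem : ∀ u x : Fin d → ℤ,
      x ∈ box (fun i => M * u i) (fun i => M * u i + M) ↔ ∀ i, x i / M = u i := by
    intro u x
    rw [mem_box]
    refine forall_congr' fun i => ?_
    rw [Int.ediv_eq_iff_of_pos hM]
    constructor <;> rintro ⟨h1, h2⟩ <;> constructor <;> linarith
  have e : E = (E.image fun x i => x i / (M : ℤ)).biUnion
      fun u => box (fun i => M * u i) (fun i => M * u i + M) := by
    ext x
    rw [Finset.mem_biUnion]
    constructor
    · intro hx
      exact ⟨_, Finset.mem_image_of_mem _ hx, (mem _ _).2 fun i => rfl⟩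
    · rintro ⟨u, hu, hx⟩
      obtain ⟨y, hy, rfl⟩ := Finset.mem_image.1 hu
      exact hE y hy x ((mem _ _).1 hx)
  rw [e]
  refine balanced_biUnion hw _ _ ?_ fun u _ => ?_
  · intro u _ v _ huv
    refine Finset.disjoint_left.2 fun x hx hx' => huv ?_
    ext i
    rw [← (mem u x).1 hx i, (mem v x).1 hx' i]
  · refine hslab _ _ ⟨0, hd⟩ (fun i' _ => by simp) ?_
    simpa using hLM

/-- A cube, minus cubes that are pairwise nested or well separated, is balanced. -/
theorem balanced_sdiff_cubes (hd : 0 < d) (hw : ∀ j i, 0 < w j i) (hL : 0 < L) (hLM : L ≤ M)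
    (hslab : ∀ (a b : Fin d → ℤ) (i : Fin d),
      (∀ i', i' ≠ i → (M : ℤ) ∣ b i' - a i') → (L : ℤ) ≤ b i - a i → Balanced w p (box a b))
    {ι : Type*} (s : Finset ι) (a : ι → Fin d → ℤ) (l : ι → ℕ) (n : ℕ) (hn : M ∣ n)
    (hl : ∀ c ∈ s, M ∣ l c)
    (hin : ∀ c ∈ s, ∀ i, (L + M : ℤ) ≤ a c i ∧ a c i + l c + (L + M) ≤ n)
    (hpair : ∀ c ∈ s, ∀ c' ∈ s, c ≠ c' →
      box (a c) (fun i => a c i + l c) ⊆ box (a c') (fun i => a c' i + l c') ∨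
      box (a c') (fun i => a c' i + l c') ⊆ box (a c) (fun i => a c i + l c) ∨
      Disjoint (box (fun i => a c i - (L + M)) (fun i => a c i + l c + (L + M)))
        (box (fun i => a c' i - (L + M)) (fun i => a c' i + l c' + (L + M)))) :
    Balanced w p (box 0 (fun _ => (n : ℤ)) \
      s.biUnion fun c => box (a c) (fun i => a c i + l c)) := by
  classical
  have hM : (0 : ℤ) < M := by exact_mod_cast hL.trans_le hLM
  induction hs : s.card using Nat.strong_induction_on generalizing s with
  | _ N ih =>
  -- A cube contained in another does not affect the union and is dropped by induction; afterwards
  -- all cubes are well separated.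
  by_cases hnest : ∃ c ∈ s, ∃ c' ∈ s, c ≠ c' ∧
      box (a c) (fun i => a c i + l c) ⊆ box (a c') (fun i => a c' i + l c')
  · obtain ⟨c, hc, c', hc', hne, hsub⟩ := hnest
    have h1 := ih (s.erase c).card (by rw [← hs]; exact Finset.card_erase_lt_of_mem hc) (s.erase c)
      (fun x hx => hl x (Finset.mem_of_mem_erase hx))
      (fun x hx => hin x (Finset.mem_of_mem_erase hx))
      (fun x hx y hy => hpair x (Finset.mem_of_mem_erase hx) y (Finset.mem_of_mem_erase hy)) rfl
    have h2 : (s.biUnion fun c => box (a c) (fun i => a c i + l c)) =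
        (s.erase c).biUnion fun c => box (a c) (fun i => a c i + l c) := by
      rw [← Finset.insert_erase hc, Finset.biUnion_insert, Finset.erase_insert_eq_erase,
        Finset.erase_idem]
      refine Finset.union_eq_right.2 (hsub.trans ?_)
      exact Finset.subset_biUnion_of_mem (fun c => box (a c) (fun i => a c i + l c))
        (Finset.mem_erase.2 ⟨hne.symm, hc'⟩)
    rw [h2]
    exact h1
  push Not at hnest
  -- Each hole is enclosed in a grid-aligned box `H c` with margin between `L` and `L + M`. The
  -- lower bound makes `H c \ Q c` an annulus; the upper bound keeps the boxes `H c` disjoint and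
  -- inside the large cube. Outside them only whole grid cells remain.
  set a' : ι → Fin d → ℤ := fun c i => M * ((a c i - L) / M) with ha'
  set b' : ι → Fin d → ℤ := fun c i => M * ((a c i + l c + L) / M + 1) with hb'
  have ha1 : ∀ c i, a' c i + L ≤ a c i := fun c i => by
    have := Int.mul_ediv_self_le (x := a c i - L) hM.ne'
    simp only [ha']
    linarith
  have ha2 : ∀ c i, a c i - (L + M) ≤ a' c i := fun c i => by
    have := Int.lt_mul_ediv_self_add (x := a c i - L) hM
    simp only [ha']
    linarith
  have hb1 : ∀ c i, a c i + l c + L ≤ b' c i := fun c i => by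
    have := Int.lt_mul_ediv_self_add (x := a c i + l c + L) hM
    simp only [hb', mul_add]
    linarith
  have hb2 : ∀ c i, b' c i ≤ a c i + l c + (L + M) := fun c i => by
    have := Int.mul_ediv_self_le (x := a c i + l c + L) hM.ne'
    simp only [hb', mul_add]
    linarith
  set H : ι → Finset (Fin d → ℤ) := fun c => box (a' c) (b' c) with hH
  set Q : ι → Finset (Fin d → ℤ) := fun c => box (a c) (fun i => a c i + l c) with hQ
  have hQH : ∀ c, Q c ⊆ H c := by
    intro c x hx
    simp only [hQ, hH, mem_box] at hx ⊢
    intro i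
    have h1 := hx i
    have h2 := ha1 c i
    have h3 := hb1 c i
    omega
  have hHin : ∀ c ∈ s, H c ⊆ box 0 (fun _ => (n : ℤ)) := by
    intro c hc x hx
    simp only [hH, mem_box, Pi.zero_apply] at hx ⊢
    intro i
    have h1 := hx i
    have h2 := ha2 c i
    have h3 := hb2 c i
    have h4 := hin c hc i
    omega
  have hHdisj : (s : Set ι).PairwiseDisjoint H := by
    intro c hc c' hc' hne
    rcases hpair c hc c' hc' hne with h | h | h
    · exact absurd h (hnest c hc c' hc' hne)
    · exact absurd h (hnest c' hc' c hc hne.symm)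
    · refine Finset.disjoint_of_subset_left ?_ (Finset.disjoint_of_subset_right ?_ h)
      all_goals
        intro x hx
        simp only [hH, mem_box] at hx ⊢
        intro i
        have h1 := hx i
        have h2 := ha2 c i
        have h3 := hb2 c i
        have h2' := ha2 c' i
        have h3' := hb2 c' i
        omega
  have heq : box 0 (fun _ => (n : ℤ)) \ s.biUnion Q =
      (box 0 (fun _ => (n : ℤ)) \ s.biUnion H) ∪ s.biUnion fun c => H c \ Q c := by
    ext x
    simp only [Finset.mem_union, Finset.mem_sdiff, Finset.mem_biUnion, not_exists, not_and]
    constructor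
    · rintro ⟨h1, h2⟩
      by_cases h : ∃ c ∈ s, x ∈ H c
      · obtain ⟨c, hc, hx⟩ := h
        exact Or.inr ⟨c, hc, hx, h2 c hc⟩
      · push Not at h
        exact Or.inl ⟨h1, h⟩
    · rintro (⟨h1, h2⟩ | ⟨c, hc, h1, h2⟩)
      · exact ⟨h1, fun c hc hx => h2 c hc (hQH c hx)⟩
      · refine ⟨hHin c hc h1, fun c' hc' hx => ?_⟩
        by_cases hcc : c = c'
        · subst hcc; exact h2 hx
        · exact Finset.disjoint_left.1 (hHdisj hc hc' hcc) h1 (hQH c' hx)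
  have hmono : ∀ {x y u : ℤ}, y / M = x / M →
      ((M * u ≤ y ↔ M * u ≤ x) ∧ (y < M * u ↔ x < M * u)) := by
    intro x y u hxy
    rw [mul_comm, ← Int.le_ediv_iff_mul_le hM, ← Int.le_ediv_iff_mul_le hM,
      ← Int.ediv_lt_iff_lt_mul hM, ← Int.ediv_lt_iff_lt_mul hM, hxy]
    exact ⟨Iff.rfl, Iff.rfl⟩
  rw [heq]
  refine Balanced.union hw ?_ (balanced_biUnion hw _ _ ?_ fun c hc => ?_) ?_
  · refine balanced_of_saturated hd hw hL hLM hslab _ fun x hx y hxy => ?_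
    obtain ⟨u, hu⟩ := hn
    simp only [Finset.mem_sdiff, Finset.mem_biUnion, not_exists, not_and, mem_box,
      Pi.zero_apply] at hx ⊢
    refine ⟨fun i => ?_, fun c hc hy => hx.2 c hc ?_⟩
    · have h1 := hx.1 i
      have h2 := (hmono (u := 0) (hxy i)).1
      have h3 := (hmono (u := u) (hxy i)).2
      rw [mul_zero] at h2
      rw [hu, Nat.cast_mul] at h1 ⊢
      exact ⟨h2.2 h1.1, h3.2 h1.2⟩
    · simp only [hH, mem_box] at hy ⊢
      exact fun i => ⟨(hmono (hxy i)).1.1 (hy i).1, (hmono (hxy i)).2.1 (hy i).2⟩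
  · intro c hc c' hc' hne
    exact Finset.disjoint_of_subset_left Finset.sdiff_subset
      (Finset.disjoint_of_subset_right Finset.sdiff_subset (hHdisj hc hc' hne))
  · refine balanced_annulus hw hslab (fun i => ?_) (fun i => ?_) (fun i => ?_) (ha1 c) (hb1 c)
    · simpa using Int.natCast_dvd_natCast.2 (hl c hc)
    · simp only [ha', hb', ← mul_sub]
      exact Dvd.intro _ rfl
    · simp
  · rw [Finset.disjoint_biUnion_right]
    intro c hc
    rw [Finset.disjoint_left]
    intro x hx hx'
    exact (Finset.mem_sdiff.1 hx).2 (Finset.mem_biUnion.2 ⟨c, hc, (Finset.mem_sdiff.1 hx').1⟩)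

end Cubes

end LatticeTiling

/-! ### Translates, separated sets and markers -/

namespace LatticeTiling

section Translate

variable {d : ℕ} {X : Type*} [AddAction (Fin d → ℤ) X]

/-- The image of `F` under the action of `v`. -/
def translate (v : Fin d → ℤ) (F : Set X) : Set X := (fun x : X => -v +ᵥ x) ⁻¹' F

@[simp]
theorem mem_translate {v : Fin d → ℤ} {F : Set X} {x : X} : x ∈ translate v F ↔ -v +ᵥ x ∈ F :=
  Iff.rfl

theorem image_vadd_eq_translate (v : Fin d → ℤ) (F : Set X) :
    (fun x : X => v +ᵥ x) '' F = translate v F := by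
  ext x
  constructor
  · rintro ⟨y, hy, rfl⟩
    simpa using hy
  · intro hx
    exact ⟨-v +ᵥ x, hx, by simp⟩

end Translate

section Measure

variable {d k : ℕ} {X : Type*} [MeasurableSpace X] {μ : Measure X}

/-- Completeness makes the isomorphism measurable on the whole space, since any subset of the
exceptional null set is measurable. -/
theorem exists_measurable_injOn (hμ : IsLebesgueProbabilitySpace μ) :
    ∃ (f : X → ℝ) (S : Set X), Measurable f ∧ μ Sᶜ = 0 ∧ Set.InjOn f S := by
  have := hμ.isComplete
  obtain ⟨ν, f, S, -, hS, hfS, hinj, hmeas, -⟩ := hμ.exists_iso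
  refine ⟨f, S, fun I hI => ?_, hS, hinj⟩
  have h1 : MeasurableSet (S ∩ f ⁻¹' I) := by
    rw [hmeas _ Set.inter_subset_left, Set.image_inter_preimage]
    refine NullMeasurableSet.inter ?_ hI.nullMeasurableSet
    rw [← compl_compl (f '' S)]
    exact (NullMeasurableSet.of_null hfS).compl
  have h2 : MeasurableSet (f ⁻¹' I \ S) :=
    measurableSet_of_null (measure_mono_null (fun x hx => hx.2) hS)
  convert h1.union h2 using 1
  ext x
  by_cases hx : x ∈ S <;> simp [hx]

theorem le_measure_limsup [IsFiniteMeasure μ] {D : ℕ → Set X} (hD : ∀ n, MeasurableSet (D n))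
    {c : ENNReal} (hc : ∀ n, c ≤ μ (D n)) : c ≤ μ (⋂ N, ⋃ n, ⋃ _ : N ≤ n, D n) := by
  have h := tendsto_measure_iInter_atTop (μ := μ) (s := fun N => ⋃ n, ⋃ _ : N ≤ n, D n)
    (fun N => (MeasurableSet.iUnion fun n => MeasurableSet.iUnion fun _ => hD n).nullMeasurableSet)
    (fun N N' h => Set.iUnion_mono fun n => Set.iUnion_mono' fun hn => ⟨h.trans hn, le_rfl⟩)
    ⟨0, measure_ne_top μ _⟩
  refine ge_of_tendsto' h fun N => (hc N).trans (measure_mono ?_)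
  exact Set.subset_iUnion_of_subset N (Set.subset_iUnion_of_subset le_rfl le_rfl)

variable [AddAction (Fin d → ℤ) X]

theorem measurableSet_translate
    (hT : ∀ v : Fin d → ℤ, MeasurePreserving (fun x : X => v +ᵥ x) μ μ) (v : Fin d → ℤ)
    {F : Set X} (hF : MeasurableSet F) : MeasurableSet (translate v F) :=
  (hT (-v)).measurable hF

theorem measure_translate
    (hT : ∀ v : Fin d → ℤ, MeasurePreserving (fun x : X => v +ᵥ x) μ μ) (v : Fin d → ℤ)
    {F : Set X} (hF : MeasurableSet F) : μ (translate v F) = μ F :=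
  (hT (-v)).measure_preimage hF.nullMeasurableSet

theorem measure_biUnion_translate_le
    (hT : ∀ v : Fin d → ℤ, MeasurePreserving (fun x : X => v +ᵥ x) μ μ) (V : Finset (Fin d → ℤ))
    {F : Set X} (hF : MeasurableSet F) : μ (⋃ v ∈ V, translate v F) ≤ V.card * μ F := by
  refine (measure_biUnion_finset_le V _).trans ?_
  simp [measure_translate hT _ hF]

theorem measure_biUnion_translate
    (hT : ∀ v : Fin d → ℤ, MeasurePreserving (fun x : X => v +ᵥ x) μ μ) (V : Finset (Fin d → ℤ))
    {F : Set X} (hF : MeasurableSet F)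
    (hV : ∀ x : X, ∀ v ∈ V, ∀ v' ∈ V, -v +ᵥ x ∈ F → -v' +ᵥ x ∈ F → v = v') :
    μ (⋃ v ∈ V, translate v F) = V.card * μ F := by
  rw [measure_biUnion_finset]
  · simp [measure_translate hT _ hF]
  · intro v hv v' hv' hne
    exact Set.disjoint_left.2 fun x hx hx' => hne (hV x v hv v' hv' hx hx')
  · exact fun v _ => measurableSet_translate hT v hF

/-- A measurable maximal `K`-separated set. -/
theorem exists_maximal_separated
    (hT : ∀ v : Fin d → ℤ, MeasurePreserving (fun x : X => v +ᵥ x) μ μ)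
    {f : X → ℝ} (hf : Measurable f) (K : Finset (Fin d → ℤ)) (hK : ∀ v ∈ K, -v ∈ K)
    (hK0 : 0 ∉ K) {Z : Set X} (hZ : MeasurableSet Z)
    (hinj : ∀ x ∈ Z, ∀ v : Fin d → ℤ, v ≠ 0 → f (v +ᵥ x) ≠ f x) :
    ∃ B ⊆ Z, MeasurableSet B ∧ (∀ x ∈ B, ∀ v ∈ K, v +ᵥ x ∉ B) ∧
      ∀ x ∈ Z, x ∈ B ∨ ∃ v ∈ K, v +ᵥ x ∈ B := by
  obtain ⟨I, hI⟩ := (TopologicalSpace.countable_countableBasis ℝ).exists_eq_range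
    ⟨_, ((TopologicalSpace.isBasis_countableBasis ℝ).exists_subset_of_mem_open
      (Set.mem_univ (0 : ℝ)) isOpen_univ).choose_spec.1⟩
  have hbasis := TopologicalSpace.isBasis_countableBasis ℝ
  have hIopen : ∀ n, IsOpen (I n) := fun n => hbasis.isOpen (by rw [hI]; exact ⟨n, rfl⟩)
  -- Each `E n` is automatically `K`-separated. Together they cover `Z`, because `f x` can be
  -- isolated by a basic open set from the finitely many other values `f (v +ᵥ x)`.
  let E : ℕ → Set X := fun n => {x | x ∈ Z ∧ f x ∈ I n ∧ ∀ v ∈ K, f (v +ᵥ x) ∉ I n}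
  have hE : ∀ n, MeasurableSet (E n) := by
    intro n
    have : E n = Z ∩ (f ⁻¹' I n ∩ ⋂ v ∈ K, (fun x => f (v +ᵥ x)) ⁻¹' (I n)ᶜ) := by
      ext x; simp [E]; tauto
    rw [this]
    refine hZ.inter ((hf (hIopen n).measurableSet).inter ?_)
    exact Finset.measurableSet_biInter _ fun v _ =>
      (hf.comp (hT v).measurable) (hIopen n).measurableSet.compl
  have hEZ : ∀ x ∈ Z, ∃ n, x ∈ E n := by
    intro x hx
    have hfin : (((K.image fun v => f (v +ᵥ x) : Finset ℝ) : Set ℝ)ᶜ) ∈ nhds (f x) := by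
      refine (Finset.finite_toSet _).isClosed.isOpen_compl.mem_nhds ?_
      simp only [Finset.coe_image, Set.mem_compl_iff, Set.mem_image, not_exists, not_and]
      intro v hv
      exact hinj x hx v (fun h => hK0 (h ▸ hv))
    obtain ⟨J, hJ, hxJ, hJsub⟩ := hbasis.mem_nhds_iff.1 hfin
    rw [hI] at hJ
    obtain ⟨n, rfl⟩ := hJ
    refine ⟨n, hx, hxJ, fun v hv hvI => hJsub hvI ?_⟩
    exact Finset.mem_coe.2 (Finset.mem_image_of_mem _ hv)
  -- Greedy choice: at stage `n`, add the points of `E n` that do not conflict with earlier choices.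
  let A : ℕ → Set X := fun n =>
    Nat.rec ∅ (fun n A => A ∪ {x | x ∈ E n ∧ ∀ v ∈ K, v +ᵥ x ∉ A}) n
  have hA0 : A 0 = ∅ := rfl
  have hAs : ∀ n, A (n + 1) = A n ∪ {x | x ∈ E n ∧ ∀ v ∈ K, v +ᵥ x ∉ A n} := fun n => rfl
  have hAmono : Monotone A := monotone_nat_of_le_succ fun n => by
    rw [hAs]; exact Set.subset_union_left
  have hAmeas : ∀ n, MeasurableSet (A n) := by
    intro n
    induction n with
    | zero => simp [hA0]
    | succ n ih =>
      have : A (n + 1) = A n ∪ (E n ∩ ⋂ v ∈ K, (fun x => v +ᵥ x) ⁻¹' (A n)ᶜ) := by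
        rw [hAs]; ext x; simp
      rw [this]
      refine ih.union ((hE n).inter ?_)
      exact Finset.measurableSet_biInter _ fun v _ => (hT v).measurable ih.compl
  have hAZ : ∀ n, A n ⊆ Z := by
    intro n
    induction n with
    | zero => simp [hA0]
    | succ n ih =>
      rw [hAs]
      exact Set.union_subset ih fun x hx => hx.1.1
  have hAsep : ∀ n, ∀ x ∈ A n, ∀ v ∈ K, v +ᵥ x ∉ A n := by
    intro n
    induction n with
    | zero => simp [hA0]
    | succ n ih =>
      rw [hAs]
      rintro x (hx | ⟨hx, hx'⟩) v hv (hvx | ⟨hvx, hvx'⟩)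
      · exact ih x hx v hv hvx
      · refine hvx' (-v) (hK v hv) ?_
        simpa using hx
      · exact hx' v hv hvx
      · exact hx.2.2 v hv hvx.2.1
  refine ⟨⋃ n, A n, Set.iUnion_subset hAZ, MeasurableSet.iUnion hAmeas, ?_, ?_⟩
  · intro x hx v hv hvx
    obtain ⟨n, hn⟩ := Set.mem_iUnion.1 hx
    obtain ⟨m, hm⟩ := Set.mem_iUnion.1 hvx
    exact hAsep (max n m) x (hAmono (le_max_left _ _) hn) v hv (hAmono (le_max_right _ _) hm)
  · intro x hx
    obtain ⟨n, hn⟩ := hEZ x hx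
    rcases Classical.em (∀ v ∈ K, v +ᵥ x ∉ A n) with h | h
    · refine Or.inl (Set.mem_iUnion.2 ⟨n + 1, ?_⟩)
      rw [hAs]
      exact Or.inr ⟨hn, h⟩
    · push Not at h
      obtain ⟨v, hv, hvx⟩ := h
      exact Or.inr ⟨v, hv, Set.mem_iUnion.2 ⟨n, hvx⟩⟩

/-- A measurable set that meets each orbit in a maximal set of points at distance at least `N`. -/
theorem exists_marker [IsFiniteMeasure μ]
    (hT : ∀ v : Fin d → ℤ, MeasurePreserving (fun x : X => v +ᵥ x) μ μ)
    {f : X → ℝ} (hf : Measurable f) {N : ℕ} (hN : 0 < N) {Z : Set X} (hZ : MeasurableSet Z)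
    (hinv : ∀ x ∈ Z, ∀ v : Fin d → ℤ, v +ᵥ x ∈ Z)
    (hinj : ∀ x ∈ Z, ∀ v : Fin d → ℤ, v ≠ 0 → f (v +ᵥ x) ≠ f x) :
    ∃ B ⊆ Z, MeasurableSet B ∧
      (∀ x ∈ B, ∀ v : Fin d → ℤ, v ≠ 0 → v +ᵥ x ∈ B → ∃ i, (N : ℤ) ≤ |v i|) ∧
      μ.real Z ≤ (2 * N : ℝ) ^ d * μ.real B ∧ (N : ℝ) ^ d * μ.real B ≤ μ.real Z := by
  set V : Finset (Fin d → ℤ) := box (fun _ => -N + 1) (fun _ => N) with hV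
  have memV : ∀ v : Fin d → ℤ, v ∈ V ↔ ∀ i, |v i| < N := by
    intro v
    rw [hV, mem_box]
    refine forall_congr' fun i => ?_
    rw [abs_lt]
    omega
  obtain ⟨B, hBZ, hB, hsep, hmax⟩ := exists_maximal_separated hT hf (V.erase 0)
    (fun v hv => by
      rw [Finset.mem_erase, memV] at hv ⊢
      simpa using hv) (by simp) hZ hinj
  have hsep' : ∀ x ∈ B, ∀ v : Fin d → ℤ, v ≠ 0 → v +ᵥ x ∈ B → ∃ i, (N : ℤ) ≤ |v i| := by
    intro x hx v hv hvx
    by_contra! hcon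
    exact hsep x hx v (Finset.mem_erase.2 ⟨hv, (memV v).2 hcon⟩) hvx
  refine ⟨B, hBZ, hB, hsep', ?_, ?_⟩
  -- By maximality the `(2 * N - 1) ^ d` translates by `V` cover `Z`; for the other bound, `N ^ d`
  -- translates are disjoint inside `Z`.
  · have h1 : Z ⊆ ⋃ v ∈ V, translate v B := by
      intro x hx
      rw [Set.mem_iUnion₂]
      rcases hmax x hx with h | ⟨v, hv, h⟩
      · refine ⟨0, (memV 0).2 fun i => by simpa using hN, by simpa using h⟩
      · refine ⟨-v, (memV _).2 ?_, by simpa using h⟩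
        simpa using (memV v).1 (Finset.mem_of_mem_erase hv)
    have h2 := (measure_mono h1).trans (measure_biUnion_translate_le hT V hB)
    have h3 : V.card ≤ (2 * N) ^ d := by
      rw [hV, card_box, Finset.prod_const, Finset.card_univ, Fintype.card_fin]
      refine Nat.pow_le_pow_left ?_ d
      omega
    have h4 := ENNReal.toReal_mono (ENNReal.mul_ne_top (by simp) (measure_ne_top μ B)) h2
    rw [ENNReal.toReal_mul, ENNReal.toReal_natCast] at h4
    refine h4.trans ?_
    refine mul_le_mul_of_nonneg_right ?_ measureReal_nonneg
    exact_mod_cast h3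
  · have h1 : (⋃ v ∈ box (d := d) 0 (fun _ => (N : ℤ)), translate v B) ⊆ Z := by
      intro x hx
      rw [Set.mem_iUnion₂] at hx
      obtain ⟨v, -, hv⟩ := hx
      simpa using hinv _ (hBZ hv) v
    have h2 := measure_biUnion_translate hT (box (d := d) 0 (fun _ => (N : ℤ))) hB (by
      intro x v hv v' hv' hx hx'
      by_contra hne
      obtain ⟨i, hi⟩ := hsep' _ hx (v - v') (sub_ne_zero.2 hne) (by
        rw [vadd_vadd]; convert hx' using 2; abel)
      rw [mem_box] at hv hv'
      have h1 := hv i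
      have h2 := hv' i
      simp only [Pi.zero_apply, Pi.sub_apply] at h1 h2 hi
      rw [le_abs] at hi
      omega)
    have h3 := measure_mono (μ := μ) h1
    rw [h2, card_box] at h3
    have h4 := ENNReal.toReal_mono (measure_ne_top μ Z) h3
    rw [ENNReal.toReal_mul, ENNReal.toReal_natCast] at h4
    simpa [measureReal_def] using h4

end Measure

/-! ### Choice of the scales -/

section Scale

/-- The displacements at which a cube of side `s`, inflated by `C`, neither lies in the cube of
side `t` nor is separated from its inflation. -/
noncomputable def clash (d C s t : ℕ) : Finset (Fin d → ℤ) :=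
  box (fun _ => -(s + 2 * C) + 1) (fun _ => t + 2 * C) \
    box (fun _ => (C : ℤ)) (fun _ => t - s - C + 1)

/-- Clashing displacements lie in a shell around the boundary of the large cube, so for fixed `s`
their number is `o(t ^ d)`. -/
theorem card_clash_le (d C : ℕ) {s t : ℕ} (hs : 0 < s) (h : s + 4 * C ≤ t) :
    ((clash d C s t).card : ℝ) ≤ (t + (s + 4 * C)) ^ d - (t - (s + 4 * C)) ^ d := by
  have hsub : box (d := d) (fun _ => (C : ℤ)) (fun _ => t - s - C + 1) ⊆
      box (fun _ => -(s + 2 * C) + 1) (fun _ => t + 2 * C) := by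
    intro x hx
    rw [mem_box] at hx ⊢
    intro i
    have := hx i
    omega
  rw [clash, Finset.card_sdiff_of_subset hsub, Nat.cast_sub (Finset.card_le_card hsub), card_box,
    card_box, Finset.prod_const, Finset.prod_const, Finset.card_univ, Fintype.card_fin]
  push_cast
  refine sub_le_sub (pow_le_pow_left₀ (by positivity) ?_ d)
    (pow_le_pow_left₀ (sub_nonneg.2 (by exact_mod_cast h)) ?_ d)
  · exact_mod_cast (by omega : (t + 2 * C - (-(s + 2 * C) + 1) : ℤ).toNat ≤ t + (s + 4 * C))
  · rw [sub_le_iff_le_add]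
    exact_mod_cast (by omega : t ≤ (t - s - C + 1 - C : ℤ).toNat + (s + 4 * C))

theorem exists_scale_aux (d c : ℕ) {ε : ℝ} (hε : 0 < ε) :
    ∀ᶠ t : ℕ in Filter.atTop, ((t : ℝ) + c) ^ d - (t - c) ^ d ≤ ε * t ^ d := by
  have h : Filter.Tendsto (fun t : ℕ => (1 + (c : ℝ) / t) ^ d - (1 - (c : ℝ) / t) ^ d)
      Filter.atTop (nhds ((1 + 0) ^ d - (1 - 0) ^ d)) := by
    have h0 := tendsto_const_div_atTop_nhds_zero_nat (c : ℝ)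
    exact ((h0.const_add 1).pow d).sub ((h0.const_sub 1).pow d)
  simp only [add_zero, sub_zero, one_pow, sub_self] at h
  filter_upwards [h.eventually_le_const hε, Filter.eventually_gt_atTop 0] with t ht ht0
  have ht0' : (0 : ℝ) < t := by exact_mod_cast ht0
  have h1 : (t : ℝ) + c = (1 + c / t) * t := by field_simp
  have h2 : (t : ℝ) - c = (1 - c / t) * t := by field_simp
  rw [h1, h2, mul_pow, mul_pow, ← sub_mul]
  exact mul_le_mul_of_nonneg_right ht (by positivity)

/-- The factors `(1 / 2) ^ (m + 2)` sum to `1 / 2`, which bounds the share of level `n` lost to all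
higher levels. The bound `4 * n + 2 * C ≤ s n` says that trimming `n` from every face leaves at
least half of `s n + 2 * C`. -/
theorem exists_scale (d C : ℕ) {M : ℕ} (hM : 0 < M) :
    ∃ s : ℕ → ℕ, (∀ n, M ∣ s n) ∧ (∀ n, 0 < s n ∧ 4 * n + 2 * C ≤ s n) ∧ ∀ n m, n < m →
      ((clash d C (s n) (s m)).card : ℝ) * (2 * (s n + 2 * C : ℕ)) ^ d ≤
        (1 / 2) ^ (m + 2) * (s m) ^ d := by
  -- The recursion sees only the set of earlier terms, not the position in the sequence. The first
  -- component is a strictly increasing counter, hence at least `n` at place `n`.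
  obtain ⟨x, hx, hxr⟩ := exists_seq_of_forall_finset_exists
    (fun x : ℕ × ℕ => M ∣ x.2 ∧ 0 < x.2 ∧ 4 * x.1 + 2 * C ≤ x.2)
    (fun x y => x.1 < y.1 ∧ ((clash d C x.2 y.2).card : ℝ) * (2 * (x.2 + 2 * C : ℕ)) ^ d ≤
        (1 / 2) ^ (y.1 + 2) * y.2 ^ d) (by
    intro F hF
    obtain ⟨j, hj⟩ : ∃ j : ℕ, ∀ x ∈ F, x.1 < j :=
      ⟨F.sup Prod.fst + 1, fun x hx => Nat.lt_succ_of_le (Finset.le_sup (f := Prod.fst) hx)⟩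
    have h1 : ∀ᶠ t : ℕ in Filter.atTop, ∀ x ∈ F,
        ((clash d C x.2 t).card : ℝ) * (2 * (x.2 + 2 * C : ℕ)) ^ d ≤
          (1 / 2) ^ (j + 2) * t ^ d := by
      rw [Filter.eventually_all_finset]
      intro x hx
      have hpos : (0 : ℝ) < (2 * (x.2 + 2 * C : ℕ)) ^ d := by
        have : 0 < x.2 := (hF x hx).2.1
        positivity
      filter_upwards [exists_scale_aux d (x.2 + 4 * C)
        (ε := (1 / 2) ^ (j + 2) / (2 * (x.2 + 2 * C : ℕ)) ^ d) (by positivity),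
        Filter.eventually_ge_atTop (x.2 + 4 * C)] with t ht htx
      rw [div_mul_eq_mul_div, le_div_iff₀ hpos] at ht
      refine le_trans (mul_le_mul_of_nonneg_right ?_ hpos.le) ht
      have := card_clash_le d C (hF x hx).2.1 htx
      push_cast
      exact this
    obtain ⟨t₀, ht₀⟩ := Filter.eventually_atTop.1 h1
    refine ⟨(j, M * (t₀ + 4 * j + 2 * C + 1)), ⟨Dvd.intro _ rfl, by positivity, ?_⟩,
      fun x hx => ⟨hj x hx, ht₀ _ ?_ x hx⟩⟩
    · have := Nat.le_mul_of_pos_left (t₀ + 4 * j + 2 * C + 1) hM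
      dsimp only
      omega
    · have := Nat.le_mul_of_pos_left (t₀ + 4 * j + 2 * C + 1) hM
      omega)
  have hmono : StrictMono fun n => (x n).1 := fun n m h => (hxr n m h).1
  have hge : ∀ n, n ≤ (x n).1 := fun n => hmono.le_apply
  refine ⟨fun n => (x n).2, fun n => (hx n).1, fun n => ⟨(hx n).2.1, ?_⟩, fun n m h => ?_⟩
  · have := (hx n).2.2
    have := hge n
    dsimp only
    omega
  · refine (hxr n m h).2.trans (mul_le_mul_of_nonneg_right ?_ (by positivity))
    exact pow_le_pow_of_le_one (by norm_num) (by norm_num) (by have := hge m; omega)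

end Scale

end LatticeTiling

/-! ### The hierarchy of cubes and its patches -/

namespace LatticeTiling

variable {d k : ℕ} {X : Type*} [AddAction (Fin d → ℤ) X]

/-- The points of `Y` lie in unique translates of balanced patches with measurable bases `F`. -/
def HasDecomposition [MeasurableSpace X] (w : Fin k → Fin d → ℕ) (p : Fin k → ℝ)
    (Y : Set X) : Prop :=
  ∃ F : Finset (Fin d → ℤ) → Set X, (∀ D, MeasurableSet (F D)) ∧
    (∀ D, (F D).Nonempty → Balanced w p D) ∧
    ∀ x ∈ Y, ∃! q : Finset (Fin d → ℤ) × (Fin d → ℤ), q.2 ∈ q.1 ∧ -q.2 +ᵥ x ∈ F q.1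

/-- The points of `B n` whose cube clashes with no cube of a higher level. -/
def unclashed (d : ℕ) {X : Type*} [AddAction (Fin d → ℤ) X] (C : ℕ) (s : ℕ → ℕ)
    (B : ℕ → Set X) (n : ℕ) : Set X :=
  {c | c ∈ B n ∧ ∀ m, n < m → ∀ v ∈ clash d C (s n) (s m), -v +ᵥ c ∉ B m}

/-- The union of the cubes of side `s n` based at unclashed points of `B n`. -/
def cubes (d : ℕ) {X : Type*} [AddAction (Fin d → ℤ) X] (C : ℕ) (s : ℕ → ℕ)
    (B : ℕ → Set X) (n : ℕ) : Set X :=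
  {x | ∃ v ∈ box (d := d) 0 (fun _ => (s n : ℤ)), -v +ᵥ x ∈ unclashed d C s B n}

open Classical in
/-- The part of the cube at `b` that is covered by no cube of a lower level. -/
noncomputable def patch (d : ℕ) {X : Type*} [AddAction (Fin d → ℤ) X] (C : ℕ) (s : ℕ → ℕ)
    (B : ℕ → Set X) (n : ℕ) (b : X) : Finset (Fin d → ℤ) :=
  (box (d := d) 0 (fun _ => (s n : ℤ))).filter fun v => ∀ m < n, v +ᵥ b ∉ cubes d C s B m

section Measurability

variable [MeasurableSpace X] {μ : Measure X} {C : ℕ} {s : ℕ → ℕ} {B : ℕ → Set X}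

theorem measurableSet_unclashed
    (hT : ∀ v : Fin d → ℤ, MeasurePreserving (fun x : X => v +ᵥ x) μ μ)
    (hB : ∀ n, MeasurableSet (B n)) (n : ℕ) : MeasurableSet (unclashed d C s B n) := by
  have : unclashed d C s B n = B n ∩ ⋂ m, ⋂ _ : n < m, ⋂ v ∈ clash d C (s n) (s m),
      (translate v (B m))ᶜ := by
    ext x
    simp [unclashed]
  rw [this]
  exact (hB n).inter (MeasurableSet.iInter fun m => MeasurableSet.iInter fun _ =>
    Finset.measurableSet_biInter _ fun v _ => (measurableSet_translate hT v (hB m)).compl)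

theorem measurableSet_cubes
    (hT : ∀ v : Fin d → ℤ, MeasurePreserving (fun x : X => v +ᵥ x) μ μ)
    (hB : ∀ n, MeasurableSet (B n)) (n : ℕ) : MeasurableSet (cubes d C s B n) := by
  have : cubes d C s B n = ⋃ v ∈ box (d := d) 0 (fun _ => (s n : ℤ)),
      translate v (unclashed d C s B n) := by
    ext x
    simp [cubes]
  rw [this]
  exact Finset.measurableSet_biUnion _ fun v _ =>
    measurableSet_translate hT v (measurableSet_unclashed hT hB n)

theorem measurableSet_patch
    (hT : ∀ v : Fin d → ℤ, MeasurePreserving (fun x : X => v +ᵥ x) μ μ)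
    (hB : ∀ n, MeasurableSet (B n)) (n : ℕ) (D : Finset (Fin d → ℤ)) :
    MeasurableSet {b | patch d C s B n b = D} := by
  have hc := measurableSet_cubes (C := C) (s := s) hT hB
  have : {b | patch d C s B n b = D} = {b | ∀ v : Fin d → ℤ,
      ((v ∈ box (d := d) 0 (fun _ => (s n : ℤ)) ∧ ∀ m < n, v +ᵥ b ∉ cubes d C s B m) ↔ v ∈ D)} := by
    ext b
    simp only [patch, Finset.ext_iff, Finset.mem_filter, Set.mem_ofPred_eq]
  rw [this]
  refine Measurable.setOf ?_
  refine Measurable.forall fun v => Measurable.iff (measurable_const.and ?_) measurable_const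
  refine Measurable.forall fun m => Measurable.forall fun _ => Measurable.not ?_
  exact (hc m).mem.comp (hT v).measurable

end Measurability

variable {C L M : ℕ} {s : ℕ → ℕ} {B : ℕ → Set X}

theorem eq_of_mem_box
    (hsep : ∀ n, ∀ b ∈ B n, ∀ u : Fin d → ℤ, u ≠ 0 → u +ᵥ b ∈ B n →
      ∃ i, ((s n + 2 * C : ℕ) : ℤ) ≤ |u i|) {n : ℕ} {x : X} {v v' : Fin d → ℤ}
    (hv : v ∈ box (d := d) 0 (fun _ => (s n : ℤ))) (hv' : v' ∈ box (d := d) 0 (fun _ => (s n : ℤ)))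
    (hx : -v +ᵥ x ∈ B n) (hx' : -v' +ᵥ x ∈ B n) : v = v' := by
  by_contra hne
  obtain ⟨i, hi⟩ := hsep n _ hx (v - v') (sub_ne_zero.2 hne) (by
    rw [vadd_vadd]; convert hx' using 2; abel)
  rw [mem_box] at hv hv'
  have h1 := hv i
  have h2 := hv' i
  simp only [Pi.zero_apply, Pi.sub_apply] at h1 h2 hi
  rw [le_abs] at hi
  omega

/-- A cube of a lower level either lies deep in a cube of a higher level or is separated from it. -/
theorem inside_or_separated {m n : ℕ} (hmn : m < n) {b c : X} {u : Fin d → ℤ} (hb : b ∈ B n)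
    (hc : c ∈ unclashed d C s B m) (hu : u +ᵥ b = c) :
    (∀ i, (C : ℤ) ≤ u i ∧ u i + s m + C ≤ s n) ∨
      ∃ i, u i + s m + 2 * C ≤ 0 ∨ (s n + 2 * C : ℤ) ≤ u i := by
  have h : u ∉ clash d C (s m) (s n) := fun h => hc.2 n hmn u h (by rw [← hu]; simpa using hb)
  rw [clash, Finset.mem_sdiff, not_and_not_right, mem_box, mem_box] at h
  by_cases h' : ∀ i, -((s m : ℤ) + 2 * C) + 1 ≤ u i ∧ u i < s n + 2 * C
  · left
    intro i
    have := h h' i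
    omega
  · right
    push Not at h'
    obtain ⟨i, hi⟩ := h'
    refine ⟨i, ?_⟩
    by_cases h2 : -((s m : ℤ) + 2 * C) + 1 ≤ u i
    · exact Or.inr (hi h2)
    · left
      omega

/-- Seen from `b`, the lower cubes meeting the cube of `b` lie deep inside it. Two of different
levels are nested or separated by absence of clashes, two of the same level are separated by the
marker spacing. As `C = L + M`, these are the margins required by `balanced_sdiff_cubes`. -/
theorem balanced_patch {w : Fin k → Fin d → ℕ} {p : Fin k → ℝ}
    (hd : 0 < d) (hw : ∀ j i, 0 < w j i) (hL : 0 < L) (hLM : L ≤ M)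
    (hslab : ∀ (a b : Fin d → ℤ) (i : Fin d),
      (∀ i', i' ≠ i → (M : ℤ) ∣ b i' - a i') → (L : ℤ) ≤ b i - a i → Balanced w p (box a b))
    (hC : C = L + M) (hs : ∀ n, M ∣ s n)
    (hsep : ∀ n, ∀ b ∈ B n, ∀ u : Fin d → ℤ, u ≠ 0 → u +ᵥ b ∈ B n →
      ∃ i, ((s n + 2 * C : ℕ) : ℤ) ≤ |u i|) {n : ℕ} {b : X} (hb : b ∈ unclashed d C s B n) :
    Balanced w p (patch d C s B n b) := by
  classical
  let I : Finset (ℕ × (Fin d → ℤ)) := (Finset.range n ×ˢ box (d := d) 0 (fun _ => (s n : ℤ))).filter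
    fun c => c.2 +ᵥ b ∈ unclashed d C s B c.1
  have memI : ∀ c, c ∈ I ↔ (c.1 < n ∧ ∀ i, 0 ≤ c.2 i ∧ c.2 i < s n) ∧
      c.2 +ᵥ b ∈ unclashed d C s B c.1 := by
    intro c
    simp [I]
  have hpatch : patch d C s B n b = box 0 (fun _ => (s n : ℤ)) \
      I.biUnion fun c => box c.2 (fun i => c.2 i + s c.1) := by
    ext x
    rw [patch, Finset.mem_filter, Finset.mem_sdiff]
    refine and_congr_right fun hx => ?_
    rw [mem_box] at hx
    simp only [Finset.mem_biUnion, memI, not_exists, not_and, mem_box]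
    constructor
    · rintro h ⟨m, u⟩ ⟨⟨hm, hu⟩, hub⟩ hxu
      dsimp only at hm hu hub hxu
      refine h m hm ⟨x - u, ?_, ?_⟩
      · rw [mem_box]
        intro i
        have := hxu i
        simp only [Pi.zero_apply, Pi.sub_apply]
        omega
      · rw [vadd_vadd]; convert hub using 2; abel
    · rintro h m hm ⟨v, hv, hvx⟩
      rw [mem_box] at hv
      rw [vadd_vadd] at hvx
      have e : -v + x = x - v := by abel
      rw [e] at hvx
      refine h (m, x - v) ⟨⟨hm, ?_⟩, hvx⟩ ?_
      -- The point `x` lies in both cubes, which excludes separation; so the corner `x - v` is in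
      -- the box and is counted by `I`.
      · rcases inside_or_separated hm hb.1 hvx rfl with h1 | ⟨i, h1⟩
        · intro i
          have h2 := h1 i
          simp only [Pi.sub_apply] at h2 ⊢
          omega
        · have h2 := hx i
          have h3 := hv i
          simp only [Pi.sub_apply, Pi.zero_apply] at h1 h2 h3
          omega
      · intro i
        have h3 := hv i
        simp only [Pi.sub_apply, Pi.zero_apply] at h3 ⊢
        omega
  have sep : ∀ {a a' : Fin d → ℤ} {l l' : ℕ} (i : Fin d),
      (a i - a' i + l + 2 * C ≤ 0 ∨ (l' + 2 * C : ℤ) ≤ a i - a' i) →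
      Disjoint (box (fun i => a i - (L + M)) (fun i => a i + l + (L + M)))
        (box (fun i => a' i - (L + M)) (fun i => a' i + l' + (L + M))) := by
    intro a a' l l' i h
    rw [Finset.disjoint_left]
    intro x hx hx'
    rw [mem_box] at hx hx'
    have h1 := hx i
    have h2 := hx' i
    subst hC
    push_cast at h
    omega
  have lower : ∀ c ∈ I, ∀ c' ∈ I, c.1 < c'.1 →
      box c.2 (fun i => c.2 i + s c.1) ⊆ box c'.2 (fun i => c'.2 i + s c'.1) ∨
      Disjoint (box (fun i => c.2 i - (L + M)) (fun i => c.2 i + s c.1 + (L + M)))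
        (box (fun i => c'.2 i - (L + M)) (fun i => c'.2 i + s c'.1 + (L + M))) := by
    intro c hc c' hc' hlt
    rw [memI] at hc hc'
    rcases inside_or_separated hlt hc'.2.1 hc.2 (u := c.2 - c'.2)
      (by rw [vadd_vadd, sub_add_cancel]) with h1 | ⟨i, h1⟩
    · left
      intro x hx
      rw [mem_box] at hx ⊢
      intro i
      have h2 := hx i
      have h3 := h1 i
      simp only [Pi.sub_apply] at h3
      omega
    · exact Or.inr (sep i h1)
  rw [hpatch]
  refine balanced_sdiff_cubes hd hw hL hLM hslab I (fun c => c.2) (fun c => s c.1) (s n) (hs n)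
    (fun c _ => hs c.1) (fun c hc i => ?_) fun c hc c' hc' hne => ?_
  · rw [memI] at hc
    rcases inside_or_separated hc.1.1 hb.1 hc.2 rfl with h1 | ⟨i', h1⟩
    · have := h1 i
      subst hC
      push_cast at this
      exact ⟨this.1, by linarith [this.2]⟩
    · have := hc.1.2 i'
      omega
  · rcases lt_trichotomy c.1 c'.1 with h | h | h
    · rcases lower c hc c' hc' h with h1 | h1
      · exact Or.inl h1
      · exact Or.inr (Or.inr h1)
    · right; right
      obtain ⟨m, u⟩ := c
      obtain ⟨m', u'⟩ := c'
      dsimp only at h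
      subst h
      rw [memI] at hc hc'
      obtain ⟨i, hi⟩ := hsep m _ hc'.2.1 (u - u')
        (sub_ne_zero.2 fun h => hne (by rw [h])) (by
          rw [vadd_vadd, sub_add_cancel]; exact hc.2.1)
      refine sep i ?_
      rw [Pi.sub_apply, le_abs] at hi
      dsimp only
      omega
    · rcases lower c' hc' c hc h with h1 | h1
      · exact Or.inr (Or.inl h1)
      · exact Or.inr (Or.inr h1.symm)

/-- The patch containing a point is that of the lowest-level cube covering it; within a level the
cubes are disjoint. -/
theorem hasDecomposition_cubes [MeasurableSpace X] {μ : Measure X}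
    (hT : ∀ v : Fin d → ℤ, MeasurePreserving (fun x : X => v +ᵥ x) μ μ)
    {w : Fin k → Fin d → ℕ} {p : Fin k → ℝ}
    (hd : 0 < d) (hw : ∀ j i, 0 < w j i) (hL : 0 < L) (hLM : L ≤ M)
    (hslab : ∀ (a b : Fin d → ℤ) (i : Fin d),
      (∀ i', i' ≠ i → (M : ℤ) ∣ b i' - a i') → (L : ℤ) ≤ b i - a i → Balanced w p (box a b))
    (hC : C = L + M) (hs : ∀ n, M ∣ s n) (hB : ∀ n, MeasurableSet (B n))
    (hsep : ∀ n, ∀ b ∈ B n, ∀ u : Fin d → ℤ, u ≠ 0 → u +ᵥ b ∈ B n →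
      ∃ i, ((s n + 2 * C : ℕ) : ℤ) ≤ |u i|) :
    HasDecomposition w p (⋃ n, cubes d C s B n) := by
  classical
  refine ⟨fun D => ⋃ n, unclashed d C s B n ∩ {b | patch d C s B n b = D}, fun D => ?_,
    fun D hD => ?_, fun x hx => ?_⟩
  · exact MeasurableSet.iUnion fun n =>
      (measurableSet_unclashed hT hB n).inter (measurableSet_patch hT hB n D)
  · obtain ⟨b, hb⟩ := hD
    obtain ⟨n, hn, rfl⟩ := Set.mem_iUnion.1 hb
    exact balanced_patch hd hw hL hLM hslab hC hs hsep hn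
  · have hx' : ∃ n, x ∈ cubes d C s B n := Set.mem_iUnion.1 hx
    obtain ⟨v, hv, hvx⟩ := Nat.find_spec hx'
    refine ⟨(patch d C s B (Nat.find hx') (-v +ᵥ x), v), ⟨?_, ?_⟩, ?_⟩
    · rw [patch, Finset.mem_filter]
      refine ⟨hv, fun m hm => ?_⟩
      rw [vadd_neg_vadd]
      exact Nat.find_min hx' hm
    · exact Set.mem_iUnion.2 ⟨_, hvx, rfl⟩
    · rintro ⟨D, u⟩ ⟨hu, hux⟩
      obtain ⟨n, hn, hD⟩ := Set.mem_iUnion.1 hux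
      replace hD : patch d C s B n (-u +ᵥ x) = D := hD
      subst hD
      dsimp only at hu hn ⊢
      rw [patch, Finset.mem_filter] at hu
      have hn' : n = Nat.find hx' := by
        refine (((Nat.find_eq_iff hx').2 ⟨⟨u, hu.1, hn⟩, fun m hm => ?_⟩)).symm
        have := hu.2 m hm
        rwa [vadd_neg_vadd] at this
      subst hn'
      have huv : u = v := eq_of_mem_box hsep hu.1 hv hn.1 hvx.1
      subst huv
      rfl

end LatticeTiling

/-! ### Exhausting the space by decomposed invariant sets -/

namespace LatticeTiling

variable {d k : ℕ} {X : Type*} [MeasurableSpace X] [AddAction (Fin d → ℤ) X]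
  {w : Fin k → Fin d → ℕ} {p : Fin k → ℝ}

theorem HasDecomposition.mono {Y Y' : Set X} (h : HasDecomposition w p Y') (hY : Y ⊆ Y') :
    HasDecomposition w p Y := by
  obtain ⟨F, h1, h2, h3⟩ := h
  exact ⟨F, h1, h2, fun x hx => h3 x (hY hx)⟩

/-- Disjointification preserves invariance, so a patch based in one piece never leaves that piece.
-/
theorem HasDecomposition.iUnion {Y : ℕ → Set X} (hY : ∀ n, MeasurableSet (Y n))
    (hinv : ∀ n, ∀ x ∈ Y n, ∀ v : Fin d → ℤ, v +ᵥ x ∈ Y n)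
    (h : ∀ n, HasDecomposition w p (Y n)) : HasDecomposition w p (⋃ n, Y n) := by
  choose F hF hbal huniq using h
  have hiff : ∀ n x (v : Fin d → ℤ), v +ᵥ x ∈ Y n ↔ x ∈ Y n := fun n x v =>
    ⟨fun hx => by simpa using hinv n _ hx (-v), fun hx => hinv n x hx v⟩
  have hdisj : ∀ n x (v : Fin d → ℤ), v +ᵥ x ∈ disjointed Y n ↔ x ∈ disjointed Y n := by
    intro n x v
    simp only [disjointed_eq_inter_compl, Set.mem_inter_iff, Set.mem_iInter, Set.mem_compl_iff,
      hiff]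
  refine ⟨fun D => ⋃ n, F n D ∩ disjointed Y n, fun D => MeasurableSet.iUnion fun n =>
    (hF n D).inter (MeasurableSet.disjointed hY n), fun D hD => ?_, fun x hx => ?_⟩
  · obtain ⟨b, hb⟩ := hD
    obtain ⟨n, hn, -⟩ := Set.mem_iUnion.1 hb
    exact hbal n D ⟨b, hn⟩
  · rw [← iUnion_disjointed] at hx
    obtain ⟨n, hn⟩ := Set.mem_iUnion.1 hx
    obtain ⟨q, ⟨hq, hqx⟩, hq'⟩ := huniq n x (disjointed_subset Y n hn)
    refine ⟨q, ⟨hq, Set.mem_iUnion.2 ⟨n, hqx, (hdisj _ _ _).2 hn⟩⟩, ?_⟩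
    rintro r ⟨hr, hrx⟩
    obtain ⟨m, hm, hm'⟩ := Set.mem_iUnion.1 hrx
    rw [hdisj] at hm'
    have hmn : m = n := by
      by_contra hne
      exact Set.disjoint_left.1 (disjoint_disjointed Y hne) hm' hn
    subst hmn
    exact hq' r ⟨hr, hm⟩

variable {μ : Measure X}

/-- Points of `B n` clashing with level `m` lie in the translates of `B m` by the clash set. Since
`μ (B m)` is at most `z / (s m) ^ d` and `z` is controlled by `μ (B n)`, these points have measure
at most `(1 / 2) ^ (m + 2) * μ (B n)`; summing over `m` gives half. -/
theorem measure_unclashed_ge [IsFiniteMeasure μ]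
    (hT : ∀ v : Fin d → ℤ, MeasurePreserving (fun x : X => v +ᵥ x) μ μ)
    {C : ℕ} {s : ℕ → ℕ} {B : ℕ → Set X} (hB : ∀ n, MeasurableSet (B n)) {z : ℝ} {n : ℕ}
    (hs0 : 0 < s n)
    (hs : ∀ m, n < m → ((clash d C (s n) (s m)).card : ℝ) * (2 * (s n + 2 * C : ℕ)) ^ d ≤
        (1 / 2) ^ (m + 2) * (s m) ^ d)
    (hz : z ≤ (2 * (s n + 2 * C : ℕ) : ℝ) ^ d * μ.real (B n))
    (hz' : ∀ m, (s m + 2 * C : ℕ) ^ d * μ.real (B m) ≤ z) :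
    μ.real (B n) ≤ 2 * μ.real (unclashed d C s B n) := by
  have hβ0 : 0 ≤ μ.real (B n) := measureReal_nonneg
  obtain ⟨β, hβ⟩ : ∃ β, β = μ.real (B n) := ⟨_, rfl⟩
  rw [← hβ] at hz hβ0 ⊢
  let bad : ℕ → Set X := fun m => ⋃ _ : n < m, ⋃ v ∈ clash d C (s n) (s m), translate v (B m)
  have hterm : ∀ m, μ (bad m) ≤ ENNReal.ofReal ((1 / 2) ^ (m + 2) * β) := by
    intro m
    by_cases hm : n < m
    · have h1 : bad m = ⋃ v ∈ clash d C (s n) (s m), translate v (B m) := by simp [bad, hm]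
      rw [h1]
      refine (measure_biUnion_translate_le hT _ (hB m)).trans ?_
      rw [← ofReal_measureReal, ← ENNReal.ofReal_natCast, ← ENNReal.ofReal_mul (by positivity)]
      refine ENNReal.ofReal_le_ofReal ?_
      have hP : (0 : ℝ) < (2 * (s n + 2 * C : ℕ)) ^ d := by positivity
      have hb : 0 ≤ μ.real (B m) := measureReal_nonneg
      have h2 : (s m : ℝ) ^ d * μ.real (B m) ≤ z := by
        refine le_trans (mul_le_mul_of_nonneg_right ?_ hb) (hz' m)
        exact_mod_cast Nat.pow_le_pow_left (by omega) d
      refine le_of_mul_le_mul_right ?_ hP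
      calc _ = ((clash d C (s n) (s m)).card : ℝ) * (2 * (s n + 2 * C : ℕ)) ^ d * μ.real (B m) := by
            ring
        _ ≤ (1 / 2) ^ (m + 2) * (s m) ^ d * μ.real (B m) :=
            mul_le_mul_of_nonneg_right (hs m hm) hb
        _ = (1 / 2) ^ (m + 2) * ((s m) ^ d * μ.real (B m)) := by ring
        _ ≤ (1 / 2) ^ (m + 2) * ((2 * (s n + 2 * C : ℕ) : ℝ) ^ d * β) :=
            mul_le_mul_of_nonneg_left (h2.trans hz) (by positivity)
        _ = _ := by ring
    · simp [bad, hm]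
  have hsum : HasSum (fun m : ℕ => (1 / 2 : ℝ) ^ (m + 2) * β) (β / 2) := by
    have h := (hasSum_geometric_two.mul_left (1 / 4 : ℝ)).mul_right β
    rw [show β / 2 = 1 / 4 * 2 * β by ring]
    refine h.congr_fun fun m => ?_
    ring
  have hbad : μ (⋃ m, bad m) ≤ ENNReal.ofReal (β / 2) := by
    refine (measure_iUnion_le _).trans ((ENNReal.tsum_le_tsum hterm).trans ?_)
    rw [← hsum.tsum_eq, ENNReal.ofReal_tsum_of_nonneg (fun m => ?_) hsum.summable]
    exact mul_nonneg (by positivity) hβ0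
  have hsub : B n ⊆ unclashed d C s B n ∪ ⋃ m, bad m := by
    intro x hx
    by_cases h : x ∈ ⋃ m, bad m
    · exact Or.inr h
    · refine Or.inl ⟨hx, fun m hm v hv hvx => h ?_⟩
      simp only [bad, Set.mem_iUnion]
      exact ⟨m, hm, v, hv, hvx⟩
  have h1 : β ≤ μ.real (unclashed d C s B n) + μ.real (⋃ m, bad m) :=
    hβ.trans_le <| (measureReal_mono hsub).trans (measureReal_union_le _ _)
  have h2 : μ.real (⋃ m, bad m) ≤ β / 2 :=
    ENNReal.toReal_le_of_le_ofReal (div_nonneg hβ0 zero_le_two) hbad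
  linarith

/-- A point at depth `n` in a cube of level `n` for infinitely many `n` has its whole orbit covered.
For every `n` the points at that depth have measure bounded below, hence so does their limsup. -/
theorem exists_subset_hasDecomposition [IsFiniteMeasure μ]
    (hT : ∀ v : Fin d → ℤ, MeasurePreserving (fun x : X => v +ᵥ x) μ μ)
    (hd : 0 < d) (hw : ∀ j i, 0 < w j i)
    (hgcd : ∀ i, Finset.univ.gcd (fun j => w j i) = 1) (hsum : ∑ j, p j = 1)
    (hp : ∀ j, 0 < p j) {f : X → ℝ} (hf : Measurable f) {Z : Set X} (hZ : MeasurableSet Z)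
    (hinv : ∀ x ∈ Z, ∀ v : Fin d → ℤ, v +ᵥ x ∈ Z)
    (hinj : ∀ x ∈ Z, ∀ v : Fin d → ℤ, v ≠ 0 → f (v +ᵥ x) ≠ f x) (hZ0 : μ Z ≠ 0) :
    ∃ Y ⊆ Z, MeasurableSet Y ∧ (∀ x ∈ Y, ∀ v : Fin d → ℤ, v +ᵥ x ∈ Y) ∧
      HasDecomposition w p Y ∧ μ Y ≠ 0 := by
  obtain ⟨M, L, hL, hLM, hslab⟩ := exists_balanced_slab hw hgcd hsum hp
  obtain ⟨C, hC⟩ : ∃ C, C = L + M := ⟨_, rfl⟩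
  obtain ⟨s, hsM, hs, hclash⟩ := exists_scale d C (hL.trans_le hLM)
  choose B hBZ hB hsep hge hle using fun n =>
    exists_marker hT hf (N := s n + 2 * C) (by have := (hs n).1; omega) hZ hinv hinj
  have hG := measurableSet_unclashed (C := C) (s := s) hT hB
  have hU := measurableSet_cubes (C := C) (s := s) hT hB
  let Y : Set X := {x | x ∈ Z ∧ ∀ v : Fin d → ℤ, ∃ n, v +ᵥ x ∈ cubes d C s B n}
  let P : ℕ → Finset (Fin d → ℤ) := fun n => box (fun _ => n) (fun _ => s n - n)
  let E : ℕ → Set X := fun n => ⋃ v ∈ P n, translate v (unclashed d C s B n)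
  have hPbox : ∀ n, P n ⊆ box (d := d) 0 (fun _ => (s n : ℤ)) := by
    intro n v hv
    simp only [P, mem_box, Pi.zero_apply] at hv ⊢
    intro i
    have := hv i
    omega
  have hE : ∀ n, MeasurableSet (E n) := fun n =>
    Finset.measurableSet_biUnion _ fun v _ => measurableSet_translate hT v (hG n)
  have hEY : (⋂ N, ⋃ n, ⋃ _ : N ≤ n, E n) ⊆ Y := by
    intro x hx
    simp only [E, Set.mem_iInter, Set.mem_iUnion] at hx
    refine ⟨?_, fun v => ?_⟩
    · obtain ⟨n, -, u, hu, hux⟩ := hx 0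
      simpa using hinv _ (hBZ n hux.1) u
    · obtain ⟨N, hN⟩ : ∃ N : ℕ, ∀ i, |v i| ≤ N := by
        refine ⟨∑ i, (v i).natAbs, fun i => ?_⟩
        rw [Int.abs_eq_natAbs]
        exact_mod_cast Finset.single_le_sum (f := fun i => (v i).natAbs)
          (fun _ _ => Nat.zero_le _) (Finset.mem_univ i)
      obtain ⟨n, hn, u, hu, hux⟩ := hx N
      refine ⟨n, v + u, ?_, ?_⟩
      · simp only [P, mem_box, Pi.zero_apply, Pi.add_apply] at hu ⊢
        intro i
        have h1 := hu i
        have h2 := abs_le.1 (hN i)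
        omega
      · have e : -(v + u) + v = -u := by abel
        rw [vadd_vadd, e]
        exact hux
  -- One factor `2 ^ d` comes from the marker density, another from trimming the cube, and the
  -- factor `2` from discarding clashes.
  have hmeas : ∀ n, ENNReal.ofReal (μ.real Z / (2 * 4 ^ d)) ≤ μ (E n) := by
    intro n
    rw [measure_biUnion_translate hT (P n) (hG n) fun x v hv v' hv' hx hx' =>
      eq_of_mem_box hsep (hPbox n hv) (hPbox n hv') hx.1 hx'.1]
    rw [← ofReal_measureReal, ← ENNReal.ofReal_natCast, ← ENNReal.ofReal_mul (by positivity)]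
    refine ENNReal.ofReal_le_ofReal ?_
    have h1 := measure_unclashed_ge hT hB (hs n).1 (hclash n) (hge n)
      (fun m => by exact_mod_cast hle m)
    have h2 : ((s n + 2 * C : ℕ) : ℝ) ^ d / 2 ^ d ≤ ((P n).card : ℝ) := by
      have h3 : (((s n + 2 * C : ℕ) : ℝ) / 2) ≤ ((s n - n - n : ℤ).toNat : ℝ) := by
        rw [div_le_iff₀ two_pos]
        have := (hs n).2
        exact_mod_cast (by omega : s n + 2 * C ≤ (s n - n - n : ℤ).toNat * 2)
      rw [card_box, Finset.prod_const, Finset.card_univ, Fintype.card_fin, ← div_pow]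
      push_cast at h3 ⊢
      exact pow_le_pow_left₀ (by positivity) h3 d
    have h4 := hge n
    rw [mul_pow] at h4
    have hN : (0 : ℝ) ≤ ((s n + 2 * C : ℕ) : ℝ) ^ d := by positivity
    have e4 : (4 : ℝ) ^ d = 2 ^ d * 2 ^ d := by rw [← mul_pow]; norm_num
    rw [div_le_iff₀ (by positivity), e4]
    rw [div_le_iff₀ (by positivity)] at h2
    have hg : 0 ≤ μ.real (unclashed d C s B n) := measureReal_nonneg
    calc μ.real Z ≤ 2 ^ d * ((s n + 2 * C : ℕ) : ℝ) ^ d * μ.real (B n) := h4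
      _ ≤ 2 ^ d * ((s n + 2 * C : ℕ) : ℝ) ^ d * (2 * μ.real (unclashed d C s B n)) :=
          mul_le_mul_of_nonneg_left h1 (by positivity)
      _ ≤ 2 ^ d * (((P n).card : ℝ) * 2 ^ d) * (2 * μ.real (unclashed d C s B n)) := by gcongr
      _ = _ := by ring
  refine ⟨Y, fun x hx => hx.1, ?_, ?_, ?_, ?_⟩
  · have : Y = Z ∩ ⋂ v : Fin d → ℤ, ⋃ n, (fun x => v +ᵥ x) ⁻¹' cubes d C s B n := by
      ext x; simp [Y]
    rw [this]
    exact hZ.inter (MeasurableSet.iInter fun v => MeasurableSet.iUnion fun n =>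
      (hT v).measurable (hU n))
  · rintro x ⟨hx, hx'⟩ v
    refine ⟨hinv x hx v, fun u => ?_⟩
    rw [vadd_vadd]
    exact hx' (u + v)
  · refine (hasDecomposition_cubes hT hd hw hL hLM hslab hC hsM hB hsep).mono fun x hx => ?_
    obtain ⟨n, hn⟩ := hx.2 0
    rw [zero_vadd] at hn
    exact Set.mem_iUnion.2 ⟨n, hn⟩
  · have h := (le_measure_limsup hE hmeas).trans (measure_mono hEY)
    refine (lt_of_lt_of_le ?_ h).ne'
    rw [ENNReal.ofReal_pos]
    have : 0 < μ.real Z := by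
      rw [measureReal_def]
      exact ENNReal.toReal_pos hZ0 (measure_ne_top μ Z)
    positivity

/-- The class `G` is closed under countable unions, so the supremum of its measures is attained; a
remainder of positive measure would contain a further member and exceed it. -/
theorem exists_conull_hasDecomposition [IsFiniteMeasure μ]
    (hT : ∀ v : Fin d → ℤ, MeasurePreserving (fun x : X => v +ᵥ x) μ μ)
    (hd : 0 < d) (hw : ∀ j i, 0 < w j i)
    (hgcd : ∀ i, Finset.univ.gcd (fun j => w j i) = 1) (hsum : ∑ j, p j = 1)
    (hp : ∀ j, 0 < p j) {f : X → ℝ} (hf : Measurable f) {Z : Set X} (hZ : MeasurableSet Z)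
    (hinv : ∀ x ∈ Z, ∀ v : Fin d → ℤ, v +ᵥ x ∈ Z)
    (hinj : ∀ x ∈ Z, ∀ v : Fin d → ℤ, v ≠ 0 → f (v +ᵥ x) ≠ f x) :
    ∃ Y ⊆ Z, MeasurableSet Y ∧ (∀ x ∈ Y, ∀ v : Fin d → ℤ, v +ᵥ x ∈ Y) ∧
      HasDecomposition w p Y ∧ μ (Z \ Y) = 0 := by
  let G : Set (Set X) := {Y | Y ⊆ Z ∧ MeasurableSet Y ∧
    (∀ x ∈ Y, ∀ v : Fin d → ℤ, v +ᵥ x ∈ Y) ∧ HasDecomposition w p Y}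
  have hempty : ∅ ∈ G := by
    refine ⟨Set.empty_subset _, MeasurableSet.empty, by simp, fun _ => ∅, by simp, by simp, by simp⟩
  have hUnion : ∀ Y : ℕ → Set X, (∀ n, Y n ∈ G) → ⋃ n, Y n ∈ G := by
    intro Y hY
    refine ⟨Set.iUnion_subset fun n => (hY n).1, MeasurableSet.iUnion fun n => (hY n).2.1,
      fun x hx v => ?_, HasDecomposition.iUnion (fun n => (hY n).2.1) (fun n => (hY n).2.2.1)
        fun n => (hY n).2.2.2⟩
    obtain ⟨n, hn⟩ := Set.mem_iUnion.1 hx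
    exact Set.mem_iUnion.2 ⟨n, (hY n).2.2.1 x hn v⟩
  obtain ⟨u, -, hu, huG⟩ := exists_seq_tendsto_sSup (S := μ '' G) ⟨_, ∅, hempty, rfl⟩
    (OrderTop.bddAbove _)
  choose Y hYG hYu using huG
  have hmem := hUnion Y hYG
  set Y₀ := ⋃ n, Y n with hY₀
  refine ⟨Y₀, hmem.1, hmem.2.1, hmem.2.2.1, hmem.2.2.2, ?_⟩
  by_contra hne
  have hsup : sSup (μ '' G) ≤ μ Y₀ :=
    le_of_tendsto' hu fun n => by rw [← hYu n]; exact measure_mono (Set.subset_iUnion Y n)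
  obtain ⟨Y', hY'Z, hY'm, hY'inv, hY'dec, hY'0⟩ := exists_subset_hasDecomposition (p := p) hT hd hw
    hgcd hsum hp hf (hZ.diff hmem.2.1) (fun x hx v => ⟨hinv x hx.1 v, fun h => hx.2 (by
      simpa using hmem.2.2.1 _ h (-v))⟩) (fun x hx => hinj x hx.1) hne
  have hU := hUnion (fun n => if n = 0 then Y₀ else Y') (fun n => by
    by_cases hn : n = 0
    · simpa [hn] using hmem
    · simpa [hn] using
        (show Y' ∈ G from ⟨hY'Z.trans Set.sdiff_subset, hY'm, hY'inv, hY'dec⟩))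
  have hsub : Y₀ ∪ Y' ⊆ ⋃ n : ℕ, if n = 0 then Y₀ else Y' :=
    Set.union_subset (Set.subset_iUnion_of_subset 0 (by simp))
      (Set.subset_iUnion_of_subset 1 (by simp))
  have h1 := (measure_mono hsub).trans ((le_sSup (Set.mem_image_of_mem μ hU)).trans hsup)
  rw [measure_union (Set.disjoint_left.2 fun x hx hx' => (hY'Z hx').2 hx) hY'm] at h1
  exact absurd h1 (not_le.2 (ENNReal.lt_add_right (measure_ne_top μ _) hY'0))

end LatticeTiling

/-! ### Splitting sets in a nonatomic space -/

namespace LatticeTiling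

section Split

variable {X : Type*} [MeasurableSpace X] {μ : Measure X}

theorem continuous_measureReal_Iic (ν : Measure ℝ) [IsFiniteMeasure ν] [NullSingletonClass ν] :
    Continuous fun t => ν.real (Set.Iic t) := by
  have hint : Integrable (fun _ : ℝ => (1 : ℝ)) ν := integrable_const 1
  have h := intervalIntegral.continuous_primitive (μ := ν) (f := fun _ => (1 : ℝ))
    (fun a b => hint.intervalIntegrable) 0
  have e : (fun t => ν.real (Set.Iic t)) =
      fun t => ν.real (Set.Iic 0) + ∫ _ in (0 : ℝ)..t, (1 : ℝ) ∂ν := by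
    ext t
    rw [← intervalIntegral.integral_Iic_sub_Iic hint.integrableOn hint.integrableOn]
    simp
  rw [e]
  exact continuous_const.add h

/-- Intermediate value theorem for the distribution function of `f` on `F`, which is continuous
because the fibres of `f` are null. -/
theorem exists_subset_measureReal_eq [IsFiniteMeasure μ] {f : X → ℝ} (hf : Measurable f)
    (hatom : ∀ t, μ (f ⁻¹' {t}) = 0) {F : Set X} (hF : MeasurableSet F) {a : ℝ} (ha : 0 ≤ a)
    (haF : a ≤ μ.real F) : ∃ A ⊆ F, MeasurableSet A ∧ μ.real A = a := by
  rcases ha.eq_or_lt with rfl | ha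
  · exact ⟨∅, Set.empty_subset _, MeasurableSet.empty, by simp⟩
  rcases haF.eq_or_lt with rfl | haF
  · exact ⟨F, le_rfl, hF, rfl⟩
  let ν : Measure ℝ := (μ.restrict F).map f
  have hν : ∀ I, MeasurableSet I → ν I = μ (f ⁻¹' I ∩ F) := fun I hI => by
    rw [Measure.map_apply hf hI, Measure.restrict_apply (hf hI)]
  have : IsFiniteMeasure ν := Measure.isFiniteMeasure_map _ _
  have : NullSingletonClass ν := ⟨fun t => by
    rw [hν _ (measurableSet_singleton t)]
    exact measure_mono_null Set.inter_subset_left (hatom t)⟩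
  have hcont := continuous_measureReal_Iic ν
  have hbot : Filter.Tendsto (fun t => ν.real (Set.Iic t)) Filter.atBot (nhds 0) := by
    have h := tendsto_measure_iInter_atBot (μ := ν) (s := fun t : ℝ => Set.Iic t)
      (fun t => measurableSet_Iic.nullMeasurableSet) (fun _ _ h => Set.Iic_subset_Iic.2 h)
      ⟨0, measure_ne_top ν _⟩
    have e : (⋂ t : ℝ, Set.Iic t) = ∅ :=
      iInter_Iic_eq_empty_iff.2 (by rw [Set.range_id']; exact not_bddBelow_univ)
    rw [e, measure_empty] at h
    exact (ENNReal.tendsto_toReal ENNReal.zero_ne_top).comp h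
  have htop : Filter.Tendsto (fun t => ν.real (Set.Iic t)) Filter.atTop (nhds (μ.real F)) := by
    have := (ENNReal.tendsto_toReal (measure_ne_top ν Set.univ)).comp (tendsto_measure_Iic_atTop ν)
    rw [hν _ MeasurableSet.univ, Set.preimage_univ, Set.univ_inter] at this
    exact this
  obtain ⟨t, ht⟩ := mem_range_of_exists_le_of_exists_ge hcont
    (hbot.eventually_le_const ha).exists (htop.eventually_const_le haF).exists
  refine ⟨f ⁻¹' Set.Iic t ∩ F, Set.inter_subset_right, (hf measurableSet_Iic).inter hF, ?_⟩
  rw [measureReal_def, ← hν _ measurableSet_Iic]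
  exact ht

theorem exists_partition [IsFiniteMeasure μ] {f : X → ℝ} (hf : Measurable f)
    (hatom : ∀ t, μ (f ⁻¹' {t}) = 0) {ι : Type*} (s : Finset ι) (hs : s.Nonempty) (a : ι → ℝ)
    (ha : ∀ i ∈ s, 0 ≤ a i) {F : Set X} (hF : MeasurableSet F) (hsum : ∑ i ∈ s, a i = μ.real F) :
    ∃ H : ι → Set X, (∀ i, MeasurableSet (H i)) ∧ (∀ i, H i ⊆ F) ∧
      (∀ i, (H i).Nonempty → i ∈ s) ∧ (∀ x ∈ F, ∃! i, x ∈ H i) ∧ ∀ i ∈ s, μ.real (H i) = a i := by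
  classical
  induction hs using Finset.Nonempty.cons_induction generalizing F with
  | singleton i =>
    refine ⟨fun j => if j = i then F else ∅, fun j => ?_, fun j => ?_, fun j => ?_, fun x hx => ?_,
      fun j hj => ?_⟩
    · by_cases h : j = i <;> simp [h, hF]
    · by_cases h : j = i <;> simp [h]
    · by_cases h : j = i <;> simp [h]
    · refine ⟨i, by simpa using hx, fun j hj => ?_⟩
      by_contra h
      simp [h] at hj
    · rw [Finset.mem_singleton] at hj
      subst hj
      simpa using hsum.symm
  | cons i s hi hs ih =>
    rw [Finset.sum_cons] at hsum
    have ha' : ∀ j ∈ s, 0 ≤ a j := fun j hj => ha j (Finset.mem_cons_of_mem hj)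
    obtain ⟨A, hAF, hA, hAa⟩ := exists_subset_measureReal_eq hf hatom hF
      (ha i (Finset.mem_cons_self i s)) (by
        have := Finset.sum_nonneg ha'
        linarith)
    obtain ⟨H, h1, h2, h3, h4, h5⟩ := ih ha' (hF.diff hA) (by
      rw [measureReal_sdiff hAF hA, hAa]
      linarith)
    have hHi : H i = ∅ := Set.not_nonempty_iff_eq_empty.1 fun h => hi (h3 i h)
    refine ⟨fun j => if j = i then A else H j, fun j => ?_, fun j => ?_, fun j => ?_, fun x hx => ?_,
      fun j hj => ?_⟩
    · by_cases h : j = i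
      · simpa [h] using hA
      · simpa [h] using h1 j
    · by_cases h : j = i
      · simpa [h] using hAF
      · simpa [h] using (h2 j).trans Set.sdiff_subset
    · by_cases h : j = i
      · simp [h]
      · simpa [h] using h3 j
    · by_cases hxA : x ∈ A
      · refine ⟨i, by simpa using hxA, fun j hj => ?_⟩
        by_contra h
        simp only [h, if_false] at hj
        exact (h2 j hj).2 hxA
      · obtain ⟨j, hj, huniq⟩ := h4 x ⟨hx, hxA⟩
        have hji : j ≠ i := by
          rintro rfl
          simp [hHi] at hj
        refine ⟨j, by simpa [hji] using hj, fun l hl => ?_⟩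
        by_cases h : l = i
        · simp [h, hxA] at hl
        · exact huniq l (by simpa [h] using hl)
    · by_cases h : j = i
      · subst h; simpa using hAa
      · simpa [h] using h5 j ((Finset.mem_cons.1 hj).resolve_left h)

end Split

variable {d k : ℕ} {w : Fin k → Fin d → ℕ} {p : Fin k → ℝ}

theorem card_tile (q : Fin k × (Fin d → ℤ)) : (tile w q).card = ∏ i, w q.1 i := by
  simp [tile, card_box]

theorem tileVolume_apply (t : Finset (Fin k × (Fin d → ℤ))) (j : Fin k) :
    tileVolume w t j = ((t.filter fun q => q.1 = j).card * ∏ i, w j i : ℕ) := by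
  simp only [tileVolume, Finset.sum_apply, card_tile]
  rw [Finset.card_filter, Finset.sum_mul, Nat.cast_sum]
  refine Finset.sum_congr rfl fun q _ => ?_
  by_cases h : q.1 = j
  · subst h; simp
  · simp [h, Ne.symm h]

/-- Several terms of the convex combination may come from the same tiling; their weights are added,
so that tilings themselves can serve as indices. -/
theorem Balanced.exists_weights {D : Finset (Fin d → ℤ)} (h : Balanced w p D) :
    ∃ (s : Finset (Finset (Fin k × (Fin d → ℤ)))) (c : Finset (Fin k × (Fin d → ℤ)) → ℝ),
      (∀ t ∈ s, IsTiling w t D) ∧ (∀ t ∈ s, 0 ≤ c t) ∧ ∑ t ∈ s, c t = 1 ∧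
        ∀ j, ∑ t ∈ s, c t * tileVolume w t j = p j * D.card := by
  classical
  rw [Balanced, mem_convexHull_iff_exists_fintype] at h
  obtain ⟨ι, _, c, z, hc, hc1, hz, hzx⟩ := h
  choose t ht hvol using hz
  have key : ∀ g : Finset (Fin k × (Fin d → ℤ)) → ℝ,
      ∑ T ∈ Finset.univ.image t, (∑ i with t i = T, c i) * g T = ∑ i, c i * g (t i) := by
    intro g
    rw [← Finset.sum_fiberwise_of_maps_to (s := Finset.univ) (t := Finset.univ.image t) (g := t)
      (fun i hi => Finset.mem_image_of_mem t hi)]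
    refine Finset.sum_congr rfl fun T _ => ?_
    rw [Finset.sum_mul]
    refine Finset.sum_congr rfl fun i hi => ?_
    rw [(Finset.mem_filter.1 hi).2]
  refine ⟨Finset.univ.image t, fun T => ∑ i with t i = T, c i, fun T hT => ?_,
    fun T _ => Finset.sum_nonneg fun i _ => hc i, ?_, fun j => ?_⟩
  · obtain ⟨i, -, rfl⟩ := Finset.mem_image.1 hT
    exact ht i
  · have := key fun _ => 1
    simpa [hc1] using this
  · rw [key fun T => tileVolume w T j]
    have := congrFun hzx j
    rw [← this]
    simp [hvol]

/-- The base of a family of patches can be partitioned according to tilings of the patch so that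
the rectangles of each kind occupy the prescribed proportion. -/
theorem exists_partition_of_balanced {X : Type*} [MeasurableSpace X] {μ : Measure X}
    [IsFiniteMeasure μ] (hp : ∀ j, 0 < p j) {f : X → ℝ} (hf : Measurable f)
    (hatom : ∀ t, μ (f ⁻¹' {t}) = 0) {D : Finset (Fin d → ℤ)}
    {F : Set X} (hF : MeasurableSet F) (hD : F.Nonempty → Balanced w p D) :
    ∃ H : Finset (Fin k × (Fin d → ℤ)) → Set X, (∀ t, MeasurableSet (H t)) ∧ (∀ t, H t ⊆ F) ∧
      (∀ t, (H t).Nonempty → IsTiling w t D) ∧ (∀ x ∈ F, ∃! t, x ∈ H t) ∧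
      ∀ j, ∑' t, ((t.filter fun q => q.1 = j).card * ∏ i, w j i : ℕ) * μ (H t) =
        ENNReal.ofReal (p j) * (D.card * μ F) := by
  -- Over an empty base `D` need not have any tiling.
  rcases F.eq_empty_or_nonempty with rfl | hne
  · exact ⟨fun _ => ∅, by simp, by simp, by simp, by simp, by simp⟩
  obtain ⟨s, c, hs, hc, hc1, hvol⟩ := (hD hne).exists_weights
  have hsne : s.Nonempty := by
    by_contra h
    rw [Finset.not_nonempty_iff_eq_empty] at h
    simp [h] at hc1
  obtain ⟨H, h1, h2, h3, h4, h5⟩ := exists_partition hf hatom s hsne (fun t => c t * μ.real F)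
    (fun t ht => mul_nonneg (hc t ht) measureReal_nonneg) hF (by rw [← Finset.sum_mul, hc1, one_mul])
  refine ⟨H, h1, h2, fun t ht => hs t (h3 t ht), h4, fun j => ?_⟩
  rw [tsum_eq_sum (s := s) fun t ht => by
    rw [Set.not_nonempty_iff_eq_empty.1 fun h => ht (h3 t h)]; simp]
  have hterm : ∀ t ∈ s, ((t.filter fun q => q.1 = j).card * ∏ i, w j i : ℕ) * μ (H t) =
      ENNReal.ofReal (c t * tileVolume w t j * μ.real F) := by
    intro t ht
    rw [← ofReal_measureReal, h5 t ht, ← ENNReal.ofReal_natCast,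
      ← ENNReal.ofReal_mul (by positivity), tileVolume_apply]
    congr 1
    ring
  rw [Finset.sum_congr rfl hterm, ← ENNReal.ofReal_sum_of_nonneg (fun t ht =>
    mul_nonneg (mul_nonneg (hc t ht) (tileVolume_nonneg t j)) measureReal_nonneg), ← Finset.sum_mul,
    hvol j, ← ofReal_measureReal (s := F), ← ENNReal.ofReal_natCast,
    ← ENNReal.ofReal_mul (by positivity), ← ENNReal.ofReal_mul (hp j).le, mul_assoc]

end LatticeTiling

/-! ### From patches to towers -/

namespace LatticeTiling

variable {d k : ℕ} {w : Fin k → Fin d → ℕ} {p : Fin k → ℝ} {X : Type*}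
  [AddAction (Fin d → ℤ) X]

/-- Every point of `Y` lies in a unique translate `v + F j` with `v` in the rectangle `w j`. -/
def IsMultiTower (w : Fin k → Fin d → ℕ) (F : Fin k → Set X) (Y : Set X) : Prop :=
  ∀ x ∈ Y, ∃! q : Fin k × (Fin d → ℤ),
    q.2 ∈ box (d := d) 0 (fun i => (w q.1 i : ℤ)) ∧ -q.2 +ᵥ x ∈ F q.1

theorem latticeRectangle_eq (v : Fin d → ℕ) :
    latticeRectangle v = (box (d := d) 0 (fun i => (v i : ℤ)) : Set (Fin d → ℤ)) := by
  ext x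
  simp only [latticeRectangle, Set.mem_ofPred_eq, Finset.mem_coe, mem_box, Pi.zero_apply]
  refine forall_congr' fun i => ?_
  omega

theorem vadd_mem_iff {Y : Set X} (hinv : ∀ x ∈ Y, ∀ v : Fin d → ℤ, v +ᵥ x ∈ Y) {x : X}
    (v : Fin d → ℤ) : v +ᵥ x ∈ Y ↔ x ∈ Y :=
  ⟨fun hx => by simpa using hinv _ hx (-v), fun hx => hinv x hx v⟩

/-- The invariant sets on which the action is free contain a base of a tower of any shape. -/
theorem exists_base_of_free {u : Fin d → ℕ} (hu : ∀ i, 0 < u i) {N : Set X}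
    (hinv : ∀ x ∈ N, ∀ v : Fin d → ℤ, v +ᵥ x ∈ N)
    (hfree : ∀ (x : X) (v : Fin d → ℤ), v ≠ 0 → v +ᵥ x ≠ x) :
    ∃ E ⊆ N, ∀ x ∈ N, ∃! v : Fin d → ℤ, v ∈ box (d := d) 0 (fun i => (u i : ℤ)) ∧ -v +ᵥ x ∈ E := by
  have hu' : ∀ i, (0 : ℤ) < u i := fun i => by exact_mod_cast hu i
  -- A chosen representative of each orbit gives, by freeness, coordinates `g x` in `ℤ^d`; the base
  -- consists of the points whose coordinates are multiples of the sides. It need not be measurable.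
  let r : X → X := fun x => Quotient.out (s := AddAction.orbitRel (Fin d → ℤ) X) (Quotient.mk _ x)
  have hr : ∀ x, ∃ g : Fin d → ℤ, g +ᵥ r x = x := by
    intro x
    have h : (AddAction.orbitRel (Fin d → ℤ) X) (r x) x :=
      Quotient.exact (s := AddAction.orbitRel (Fin d → ℤ) X) (Quotient.out_eq _)
    rw [AddAction.orbitRel_apply, AddAction.mem_orbit_iff] at h
    obtain ⟨g, hg⟩ := h
    exact ⟨-g, by rw [← hg]; simp⟩
  have hrv : ∀ x (v : Fin d → ℤ), r (v +ᵥ x) = r x := by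
    intro x v
    simp only [r]
    congr 1
    refine Quotient.sound (s := AddAction.orbitRel (Fin d → ℤ) X) ?_
    change (AddAction.orbitRel (Fin d → ℤ) X) _ _
    rw [AddAction.orbitRel_apply]
    exact ⟨v, rfl⟩
  choose g hg using hr
  have hgv : ∀ x (v : Fin d → ℤ), g (v +ᵥ x) = v + g x := by
    intro x v
    by_contra hne
    refine hfree (r x) (-(v + g x) + g (v +ᵥ x)) (fun h => hne ?_) ?_
    · rwa [neg_add_eq_zero, eq_comm] at h
    · have h1 := hg (v +ᵥ x)
      rw [hrv] at h1
      rw [← vadd_vadd, h1, neg_add_rev, ← vadd_vadd, neg_vadd_vadd]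
      nth_rewrite 2 [← hg x]
      rw [neg_vadd_vadd]
  refine ⟨{x | x ∈ N ∧ ∀ i, (u i : ℤ) ∣ g x i}, fun x hx => hx.1, fun x hx => ?_⟩
  refine ⟨fun i => g x i % u i, ⟨?_, hinv x hx _, fun i => ?_⟩, ?_⟩
  · rw [mem_box]
    exact fun i => ⟨Int.emod_nonneg _ (hu' i).ne', Int.emod_lt_of_pos _ (hu' i)⟩
  · rw [hgv, Pi.add_apply, Pi.neg_apply, neg_add_eq_sub]
    exact Int.dvd_self_sub_emod
  · rintro v ⟨hv, -, hvx⟩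
    ext i
    have h1 := hvx i
    rw [hgv, Pi.add_apply, Pi.neg_apply, neg_add_eq_sub] at h1
    rw [mem_box] at hv
    have h2 : g x i % u i = v i % u i :=
      Int.emod_eq_emod_iff_emod_sub_eq_zero.2 (Int.emod_eq_zero_of_dvd h1)
    rw [h2]
    exact (Int.emod_eq_of_lt (hv i).1 (hv i).2).symm

section Measure

variable [MeasurableSpace X] {μ : Measure X}

/-- Over the piece of a patch base assigned to a tiling `t`, the base of type `j` receives the
corners of the tiles of type `j` in `t`. A point determines its patch, then the tiling, then its
tile, which gives uniqueness. -/
theorem HasDecomposition.exists_isMultiTower [IsFiniteMeasure μ]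
    (hT : ∀ v : Fin d → ℤ, MeasurePreserving (fun x : X => v +ᵥ x) μ μ)
    (hw : ∀ j i, 0 < w j i) (hp : ∀ j, 0 < p j) {f : X → ℝ} (hf : Measurable f)
    (hatom : ∀ t, μ (f ⁻¹' {t}) = 0) {Y : Set X} (hY : MeasurableSet Y)
    (hinv : ∀ x ∈ Y, ∀ v : Fin d → ℤ, v +ᵥ x ∈ Y) (h : HasDecomposition w p Y) :
    ∃ F : Fin k → Set X, (∀ j, MeasurableSet (F j)) ∧ (∀ j, F j ⊆ Y) ∧ IsMultiTower w F Y ∧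
      ∀ j, (∏ i, w j i : ℕ) * μ (F j) = ENNReal.ofReal (p j) * μ Y := by
  classical
  obtain ⟨A, hA, hbal, huniq⟩ := h
  choose H hHm hHA hHt hHu hHvol using fun D => exists_partition_of_balanced (μ := μ) hp hf hatom
    ((hA D).inter hY) (fun hne => hbal D (hne.mono Set.inter_subset_left))
  have huniq' : ∀ x ∈ Y, ∀ {D D' : Finset (Fin d → ℤ)} {v v' : Fin d → ℤ}, v ∈ D → v' ∈ D' →
      -v +ᵥ x ∈ A D → -v' +ᵥ x ∈ A D' → D = D' ∧ v = v' := by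
    intro x hx D D' v v' hv hv' hvx hvx'
    have := (huniq x hx).unique (y₁ := (D, v)) (y₂ := (D', v')) ⟨hv, hvx⟩ ⟨hv', hvx'⟩
    exact Prod.mk.inj this
  have hHuniq : ∀ x, ∀ {D : Finset (Fin d → ℤ)} {t t' : Finset (Fin k × (Fin d → ℤ))},
      x ∈ H D t → x ∈ H D t' → t = t' := fun x {D t t'} h h' =>
    (hHu D x (hHA D t h)).unique h h'
  have hmemD : ∀ {D : Finset (Fin d → ℤ)} {t : Finset (Fin k × (Fin d → ℤ))}
      {q : Fin k × (Fin d → ℤ)} {r : Fin d → ℤ}, IsTiling w t D → q ∈ t →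
      r ∈ box (d := d) 0 (fun i => (w q.1 i : ℤ)) → r + q.2 ∈ D ∧ r + q.2 ∈ tile w q := by
    intro D t q r ht hq hr
    have h1 : r + q.2 ∈ tile w q := by
      rw [tile, mem_box]
      rw [mem_box] at hr
      intro i
      have := hr i
      simp only [Pi.zero_apply, Pi.add_apply] at this ⊢
      omega
    exact ⟨by rw [← ht.cover]; exact Finset.mem_biUnion.2 ⟨q, hq, h1⟩, h1⟩
  have hzero : ∀ j, (0 : Fin d → ℤ) ∈ box (d := d) 0 (fun i => (w j i : ℤ)) := by
    intro j
    simpa using hw j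
  -- the translates of the pieces of the partition determine their indices
  have hpieces : ∀ x, ∀ {D D' : Finset (Fin d → ℤ)} {t t' : Finset (Fin k × (Fin d → ℤ))}
      {q q' : Fin k × (Fin d → ℤ)} {r r' : Fin d → ℤ}, q ∈ t → q' ∈ t' →
      r ∈ box (d := d) 0 (fun i => (w q.1 i : ℤ)) → r' ∈ box (d := d) 0 (fun i => (w q'.1 i : ℤ)) →
      -(r + q.2) +ᵥ x ∈ H D t → -(r' + q'.2) +ᵥ x ∈ H D' t' →
      D = D' ∧ t = t' ∧ q = q' ∧ r = r' := by
    intro x D D' t t' q q' r r' hq hq' hr hr' hx hx'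
    have hxY : x ∈ Y := (vadd_mem_iff hinv _).1 (hHA D t hx).2
    have ht := hHt D t ⟨_, hx⟩
    have ht' := hHt D' t' ⟨_, hx'⟩
    obtain ⟨rfl, hrr⟩ := huniq' x hxY (hmemD ht hq hr).1 (hmemD ht' hq' hr').1
      (hHA D t hx).1 (hHA D' t' hx').1
    rw [← hrr] at hx'
    obtain rfl := hHuniq _ hx hx'
    have hqq : q = q' := by
      by_contra hne
      refine Finset.disjoint_left.1 (ht.disj hq hq' hne) (hmemD ht hq hr).2 ?_
      rw [hrr]
      exact (hmemD ht hq' hr').2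
    subst hqq
    exact ⟨rfl, rfl, rfl, add_right_cancel hrr⟩
  let P : Fin k → Finset (Fin d → ℤ) → Finset (Fin k × (Fin d → ℤ)) → Set X := fun j D t =>
    ⋃ q ∈ t.filter fun q => q.1 = j, translate q.2 (H D t)
  have memP : ∀ {j D t x}, x ∈ P j D t ↔ ∃ q ∈ t, q.1 = j ∧ -q.2 +ᵥ x ∈ H D t := by
    intro j D t x
    simp [P, and_assoc]
  have hPm : ∀ j D t, MeasurableSet (P j D t) := fun j D t =>
    Finset.measurableSet_biUnion _ fun q _ => measurableSet_translate hT q.2 (hHm D t)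
  have hPu : ∀ x, ∀ {j D D' t t'}, x ∈ P j D t → x ∈ P j D' t' → D = D' ∧ t = t' := by
    intro x j D D' t t' hx hx'
    obtain ⟨q, hq, -, hqx⟩ := memP.1 hx
    obtain ⟨q', hq', -, hqx'⟩ := memP.1 hx'
    have := hpieces x hq hq' (hzero _) (hzero _) (by simpa using hqx) (by simpa using hqx')
    exact ⟨this.1, this.2.1⟩
  refine ⟨fun j => ⋃ D, ⋃ t, P j D t, fun j => MeasurableSet.iUnion fun D =>
    MeasurableSet.iUnion fun t => hPm j D t, fun j x hx => ?_, fun x hx => ?_, fun j => ?_⟩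
  · simp only [Set.mem_iUnion] at hx
    obtain ⟨D, t, hx⟩ := hx
    obtain ⟨q, -, -, hqx⟩ := memP.1 hx
    exact (vadd_mem_iff hinv _).1 (hHA D t hqx).2
  · obtain ⟨⟨D, v⟩, ⟨hv, hvx⟩, -⟩ := huniq x hx
    dsimp only at hv hvx
    obtain ⟨t, ht, -⟩ := hHu D _ ⟨hvx, hinv x hx _⟩
    have htD := hHt D t ⟨_, ht⟩
    rw [← htD.cover] at hv
    obtain ⟨q, hq, hqv⟩ := Finset.mem_biUnion.1 hv
    have hr : v - q.2 ∈ box (d := d) 0 (fun i => (w q.1 i : ℤ)) := by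
      rw [tile, mem_box] at hqv
      rw [mem_box]
      intro i
      have := hqv i
      simp only [Pi.zero_apply, Pi.sub_apply]
      omega
    have hadd : ∀ (q : Fin k × (Fin d → ℤ)) (r : Fin d → ℤ),
        -q.2 +ᵥ (-r +ᵥ x) = -(r + q.2) +ᵥ x := by
      intro q r
      rw [vadd_vadd, neg_add_rev]
    have hvt : -(v - q.2 + q.2) +ᵥ x ∈ H D t := by rwa [sub_add_cancel]
    refine ⟨(q.1, v - q.2), ⟨hr, ?_⟩, ?_⟩
    · simp only [Set.mem_iUnion]
      refine ⟨D, t, memP.2 ⟨q, hq, rfl, ?_⟩⟩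
      rw [hadd]
      exact hvt
    · rintro ⟨j, r⟩ ⟨hr', hrx⟩
      simp only [Set.mem_iUnion] at hrx
      obtain ⟨D', t', hx'⟩ := hrx
      obtain ⟨q', hq', rfl, hqx'⟩ := memP.1 hx'
      rw [hadd] at hqx'
      obtain ⟨-, -, rfl, rfl⟩ := hpieces x hq hq' hr hr' hvt hqx'
      rfl
  · have hP : ∀ D t, μ (P j D t) = (t.filter fun q => q.1 = j).card * μ (H D t) := by
      intro D t
      rw [measure_biUnion_finset]
      · simp [measure_translate hT _ (hHm D t)]
      · intro q hq q' hq' hne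
        refine Set.disjoint_left.2 fun x hx hx' => hne ?_
        rw [mem_translate] at hx hx'
        exact (hpieces x (Finset.mem_filter.1 hq).1 (Finset.mem_filter.1 hq').1 (hzero _) (hzero _)
          (by simpa using hx) (by simpa using hx')).2.2.1
      · exact fun q _ => measurableSet_translate hT q.2 (hHm D t)
    -- The patches partition `Y`, so the proportion `p j`, exact on each patch shape, is inherited
    -- by the sum.
    have hYeq : Y = ⋃ D, ⋃ v ∈ D, translate v (A D ∩ Y) := by
      ext x
      simp only [Set.mem_iUnion, mem_translate, Set.mem_inter_iff, vadd_mem_iff hinv]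
      constructor
      · intro hx
        obtain ⟨q, hq, -⟩ := huniq x hx
        exact ⟨q.1, q.2, hq.1, hq.2, hx⟩
      · rintro ⟨D, v, -, -, hx⟩
        exact hx
    have hYm : μ Y = ∑' D : Finset (Fin d → ℤ), D.card * μ (A D ∩ Y) := by
      conv_lhs => rw [hYeq]
      rw [measure_iUnion]
      · refine tsum_congr fun D => measure_biUnion_translate hT D ((hA D).inter hY) ?_
        intro x v hv v' hv' hx hx'
        exact (huniq' x ((vadd_mem_iff hinv _).1 hx.2) hv hv' hx.1 hx'.1).2
      · intro D D' hne
        refine Set.disjoint_left.2 fun x hx hx' => hne ?_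
        simp only [Set.mem_iUnion] at hx hx'
        obtain ⟨v, hv, hx⟩ := hx
        obtain ⟨v', hv', hx'⟩ := hx'
        exact (huniq' x ((vadd_mem_iff hinv _).1 hx.2) hv hv' hx.1 hx'.1).1
      · exact fun D => Finset.measurableSet_biUnion _ fun v _ =>
          measurableSet_translate hT v ((hA D).inter hY)
    rw [measure_iUnion, hYm, ← ENNReal.tsum_mul_left, ← ENNReal.tsum_mul_left]
    · refine tsum_congr fun D => ?_
      rw [← hHvol D j, measure_iUnion, ← ENNReal.tsum_mul_left]
      · refine tsum_congr fun t => ?_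
        rw [hP]
        push_cast
        ring
      · exact fun t t' hne => Set.disjoint_left.2 fun x hx hx' => hne (hPu x hx hx').2
      · exact hPm j D
    · refine fun D D' hne => Set.disjoint_left.2 fun x hx hx' => hne ?_
      obtain ⟨t, hx⟩ := Set.mem_iUnion.1 hx
      obtain ⟨t', hx'⟩ := Set.mem_iUnion.1 hx'
      exact (hPu x hx hx').1
    · exact fun D => MeasurableSet.iUnion (hPm j D)

/-- The towers over the bases of a multi-tower. -/
theorem IsMultiTower.exists_towers
    (hT : ∀ v : Fin d → ℤ, MeasurePreserving (fun x : X => v +ᵥ x) μ μ)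
    {F : Fin k → Set X} (hF : ∀ j, MeasurableSet (F j)) {Y : Set X}
    (hinv : ∀ x ∈ Y, ∀ v : Fin d → ℤ, v +ᵥ x ∈ Y) (hFY : ∀ j, F j ⊆ Y)
    (h : IsMultiTower w F Y) :
    ∃ τ : Fin k → Set X, (∀ j, IsRohlinTower (w j) (τ j)) ∧
      (∀ j, μ (τ j) = (∏ i, w j i : ℕ) * μ (F j)) ∧ (∀ j j', j ≠ j' → τ j ∩ τ j' = ∅) ∧
      ⋃ j, τ j = Y := by
  have huniq : ∀ x, ∀ {j j' : Fin k} {v v' : Fin d → ℤ},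
      v ∈ box (d := d) 0 (fun i => (w j i : ℤ)) → v' ∈ box (d := d) 0 (fun i => (w j' i : ℤ)) →
      -v +ᵥ x ∈ F j → -v' +ᵥ x ∈ F j' → j = j' ∧ v = v' := by
    intro x j j' v v' hv hv' hx hx'
    have := (h x ((vadd_mem_iff hinv _).1 (hFY j hx))).unique (y₁ := (j, v)) (y₂ := (j', v'))
      ⟨hv, hx⟩ ⟨hv', hx'⟩
    exact Prod.mk.inj this
  refine ⟨fun j => ⋃ v ∈ box (d := d) 0 (fun i => (w j i : ℤ)), translate v (F j), fun j =>
    ⟨F j, hF j, ?_, ?_⟩, fun j => ?_, fun j j' hne => ?_, ?_⟩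
  · rw [latticeRectangle_eq]
    intro v hv v' hv' hne
    dsimp only [Function.onFun]
    rw [image_vadd_eq_translate, image_vadd_eq_translate]
    exact Set.disjoint_left.2 fun x hx hx' => hne (huniq x hv hv' hx hx').2
  · rw [latticeRectangle_eq]
    simp only [image_vadd_eq_translate, Finset.mem_coe]
  · rw [measure_biUnion_translate hT _ (hF j) fun x v hv v' hv' hx hx' => (huniq x hv hv' hx hx').2]
    simp [card_box]
  · rw [← Set.disjoint_iff_inter_eq_empty]
    refine Set.disjoint_left.2 fun x hx hx' => hne ?_
    simp only [Set.mem_iUnion, mem_translate] at hx hx'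
    obtain ⟨v, hv, hx⟩ := hx
    obtain ⟨v', hv', hx'⟩ := hx'
    exact (huniq x hv hv' hx hx').1
  · ext x
    simp only [Set.mem_iUnion, mem_translate]
    constructor
    · rintro ⟨j, v, -, hx⟩
      exact (vadd_mem_iff hinv _).1 (hFY j hx)
    · intro hx
      obtain ⟨q, hq, -⟩ := h x hx
      exact ⟨q.1, q.2, hq.1, hq.2⟩

/-- A free point of positive mass would have arbitrarily many distinct translates of the same mass.
-/
theorem measure_eq_zero_of_subsingleton [IsFiniteMeasure μ] (hd : 0 < d)
    (hT : ∀ v : Fin d → ℤ, MeasurePreserving (fun x : X => v +ᵥ x) μ μ) {A : Set X}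
    (hA : MeasurableSet A) (hsub : A.Subsingleton)
    (hfree : ∀ x ∈ A, ∀ v : Fin d → ℤ, v ≠ 0 → v +ᵥ x ≠ x) : μ A = 0 := by
  have hle : ∀ n : ℕ, (n : ℝ) * μ.real A ≤ μ.real Set.univ := by
    intro n
    have h := measure_biUnion_translate hT (box (d := d) 0 (fun _ => (n : ℤ))) hA (by
      intro x v _ v' _ hx hx'
      by_contra hne
      refine hfree _ hx (v - v') (sub_ne_zero.2 hne) (hsub ?_ hx)
      rw [vadd_vadd]
      convert hx' using 2
      abel)
    have h2 := measureReal_mono (μ := μ)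
      (Set.subset_univ (⋃ v ∈ box (d := d) 0 (fun _ => (n : ℤ)), translate v A))
    rw [measureReal_def, h, ENNReal.toReal_mul, ENNReal.toReal_natCast] at h2
    refine le_trans (mul_le_mul_of_nonneg_right ?_ ENNReal.toReal_nonneg) h2
    rw [card_box]
    simp only [Pi.zero_apply, sub_zero, Int.toNat_natCast, Finset.prod_const, Finset.card_univ,
      Fintype.card_fin]
    exact_mod_cast Nat.le_self_pow hd.ne' n
  by_contra hne
  have hpos : 0 < μ.real A := ENNReal.toReal_pos hne (measure_ne_top μ A)
  obtain ⟨n, hn⟩ := exists_nat_gt (μ.real Set.univ / μ.real A)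
  rw [div_lt_iff₀ hpos] at hn
  exact absurd (hle n) (not_le.2 hn)

end Measure

end LatticeTiling

/-! ### Proof of the theorem -/

open LatticeTiling

theorem mainTheorem3 {d : ℕ} (hd : 0 < d) {k : ℕ}
    (w : Fin k → Fin d → ℕ) (hw : ∀ j i, 0 < w j i)
    (hgcd : ∀ i, Finset.univ.gcd (fun j => w j i) = 1)
    (p : Fin k → ℝ) (hp : ∀ j, 0 < p j) (hsum : ∑ j, p j = 1)
    {X : Type*} [MeasurableSpace X] (μ : Measure X) (hμ : IsLebesgueProbabilitySpace μ)
    [AddAction (Fin d → ℤ) X]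
    (hT : ∀ v : Fin d → ℤ, MeasurePreserving (fun x : X => v +ᵥ x) μ μ)
    (hfree : ∀ᵐ x ∂μ, ∀ v : Fin d → ℤ, v ≠ 0 → v +ᵥ x ≠ x) :
    ∃ τ : Fin k → Set X,
      (∀ j, IsRohlinTower (w j) (τ j)) ∧
      (∀ j, μ (τ j) = ENNReal.ofReal (p j)) ∧
      (∀ j j', j ≠ j' → τ j ∩ τ j' = ∅) ∧
      μ (⋃ j, τ j)ᶜ = 0 ∧
      ((∀ (x : X) (v : Fin d → ℤ), v ≠ 0 → v +ᵥ x ≠ x) → ⋃ j, τ j = Set.univ) := by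
  have := hμ.isProbabilityMeasure
  have := hμ.isComplete
  obtain ⟨f, S, hf, hS, hfS⟩ := exists_measurable_injOn hμ
  -- An invariant conull set of free orbits on each of which `f` is injective.
  let Z : Set X := {x | (∀ v : Fin d → ℤ, v +ᵥ x ∈ S) ∧ ∀ v : Fin d → ℤ, v ≠ 0 → v +ᵥ x ≠ x}
  have hZ0 : μ Zᶜ = 0 := by
    have h1 : ∀ᵐ x ∂μ, ∀ v : Fin d → ℤ, v +ᵥ x ∈ S :=
      ae_all_iff.2 fun v => (hT v).quasiMeasurePreserving.ae (p := fun x => x ∈ S) hS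
    have h2 : ∀ᵐ x ∂μ, x ∈ Z := h1.and hfree
    exact h2
  have hZm : MeasurableSet Z := MeasurableSet.of_compl (measurableSet_of_null hZ0)
  have hZinv : ∀ x ∈ Z, ∀ v : Fin d → ℤ, v +ᵥ x ∈ Z := by
    rintro x ⟨h1, h2⟩ v
    refine ⟨fun u => ?_, fun u hu h => h2 u hu ?_⟩
    · rw [vadd_vadd]
      exact h1 _
    · rw [vadd_vadd, add_comm, ← vadd_vadd] at h
      exact vadd_left_cancel v h
  have hZinj : ∀ x ∈ Z, ∀ v : Fin d → ℤ, v ≠ 0 → f (v +ᵥ x) ≠ f x := fun x hx v hv h =>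
    hx.2 v hv (hfS (hx.1 v) (by simpa using hx.1 0) h)
  have hatom : ∀ t, μ (f ⁻¹' {t}) = 0 := by
    intro t
    have h1 : μ (f ⁻¹' {t} ∩ Z) = 0 := by
      refine measure_eq_zero_of_subsingleton hd hT ((hf (measurableSet_singleton t)).inter hZm)
        (fun x hx y hy => hfS (by simpa using hx.2.1 0) (by simpa using hy.2.1 0) ?_)
        fun x hx => hx.2.2
      rw [show f x = t from hx.1, show f y = t from hy.1]
    rw [← measure_inter_add_sdiff _ hZm, h1, zero_add]
    exact measure_mono_null (fun x hx => hx.2) hZ0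
  obtain ⟨Y, hYZ, hYm, hYinv, hYdec, hZY⟩ :=
    exists_conull_hasDecomposition (p := p) hT hd hw hgcd hsum hp hf hZm hZinv hZinj
  have hY0 : μ Yᶜ = 0 := by
    refine measure_mono_null (t := Zᶜ ∪ (Z \ Y)) (fun x hx => ?_) (measure_union_null hZ0 hZY)
    by_cases h : x ∈ Z
    · exact Or.inr ⟨h, hx⟩
    · exact Or.inl h
  have hY1 : μ Y = 1 := (prob_compl_eq_zero_iff hYm).1 hY0
  obtain ⟨F, hF, hFY, htower, hvol⟩ :=
    hYdec.exists_isMultiTower hT hw hp hf hatom hYm hYinv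
  simp only [hY1, mul_one] at hvol
  -- If the action is free everywhere, the invariant null set `Yᶜ` is tiled by a single shape `w
  -- j₀`. The added base is null, hence measurable by completeness, and changes no tower's measure.
  by_cases hall : ∀ (x : X) (v : Fin d → ℤ), v ≠ 0 → v +ᵥ x ≠ x
  · have hk : Nonempty (Fin k) := by
      by_contra h
      rw [not_nonempty_iff] at h
      simp at hsum
    obtain ⟨j₀⟩ := hk
    have hNinv : ∀ x ∈ Yᶜ, ∀ v : Fin d → ℤ, v +ᵥ x ∈ Yᶜ := fun x hx v h =>
      hx ((vadd_mem_iff hYinv v).1 h)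
    obtain ⟨E, hEN, hE⟩ := exists_base_of_free (hw j₀) hNinv hall
    have hE0 : μ E = 0 := measure_mono_null hEN hY0
    let F' : Fin k → Set X := fun j => F j ∪ {x | x ∈ E ∧ j = j₀}
    have hnull : ∀ j, μ {x | x ∈ E ∧ j = j₀} = 0 := fun j =>
      measure_mono_null (fun x hx => hx.1) hE0
    have hF'μ : ∀ j, μ (F' j) = μ (F j) := fun j =>
      le_antisymm ((measure_union_le _ _).trans (by rw [hnull, add_zero]))
        (measure_mono Set.subset_union_left)
    have htower' : IsMultiTower w F' Set.univ := by
      intro x _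
      by_cases hx : x ∈ Y
      · obtain ⟨q, ⟨hq, hqx⟩, huniq⟩ := htower x hx
        refine ⟨q, ⟨hq, Or.inl hqx⟩, ?_⟩
        rintro r ⟨hr, hrx | hrx⟩
        · exact huniq r ⟨hr, hrx⟩
        · exact absurd (hYinv x hx _) (hEN hrx.1)
      · obtain ⟨v, ⟨hv, hvx⟩, huniq⟩ := hE x hx
        refine ⟨(j₀, v), ⟨hv, Or.inr ⟨hvx, rfl⟩⟩, ?_⟩
        rintro ⟨j, u⟩ ⟨hr, hrx | ⟨hrx, hj⟩⟩
        · exact absurd (hFY _ hrx) (hNinv x hx _)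
        · dsimp only at hj
          subst hj
          rw [huniq u ⟨hr, hrx⟩]
    obtain ⟨τ, h1, h2, h3, h4⟩ := htower'.exists_towers hT
      (fun j => (hF j).union (measurableSet_of_null (hnull j))) (fun x _ v => Set.mem_univ _)
      (fun j => Set.subset_univ _)
    refine ⟨τ, h1, fun j => ?_, h3, by simp [h4], fun _ => h4⟩
    rw [h2 j, hF'μ, hvol]
  · obtain ⟨τ, h1, h2, h3, h4⟩ := htower.exists_towers hT hF hYinv hFY
    exact ⟨τ, h1, fun j => by rw [h2 j, hvol], h3, by rw [h4, hY0], fun h => absurd h hall⟩
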